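/- Let $K$ be a field of characteristic zero, complete with respect to a nontrivial ultrametric absolute value $|\cdot|$, whose residue field $\Bbbk=\{|x|\le 1\}/\{|x|<1\}$ also has characteristic zero. For $0<r\le\infty$ put $D_r(0)=\{x\in K:|x|<r\}$, $\overline D_r(0)=\{x\in K:|x|\le r\}$, $S_r(0)=\{x\in K:|x|=r\}$ (so $D_\infty(0)=\overline D_\infty(0)=K$ and $S_\infty(0)=\emptyset$). Let $\lambda\in K$ with $|\lambda|=1$, $\lambda$ not a root of unity, and let $\overline\lambda$ be its class in $\Bbbk$. For a power series $f(x)=\lambda x+\sum_{i\ge2}a_ix^i\in K[[x]]$ put $a=\sup_{i\ge2}|a_i|^{1/(i-1)}$ and assume $a<\infty$; if $a=0$ (that is, $f(x)=\lambda x$), read $1/a$ and $\rho$ below as $\infty$. Then there is a unique formal power series $g(x)=x+\sum_{k\ge2}b_kx^k$ with $g\circ f=\lambda g$. Moreover the linearization disc $\Delta_f$ exists (uniquely): it is the largest disc $U$ in $K$ about the origin such that $g$ converges and is one-to-one on $U$ and $g(f(x))=\lambda g(x)$ holds for all $x\in U$ (in particular $f$ converges at $x$ and $g$ converges at $f(x)$).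 It satisfies the following. 1. If $\overline\lambda$ is not a root of unity in $\Bbbk$, then $D_{1/a}(0)\subseteq\Delta_f\subseteq\overline D_{1/a}(0)$. If in addition the supremum $a$ is attained by some $|a_i|^{1/(i-1)}$ with $i\ge2$, or $f$ diverges at every point of the sphere $S_{1/a}(0)$, then $\Delta_f=D_{1/a}(0)$. 2. If $\overline\lambda$ is a root of unity in $\Bbbk$, then there is a smallest integer $m\ge1$ with $|1-\lambda^m|<1$, and $D_\rho(0)\subseteq\Delta_f\subseteq\overline D_{1/a}(0)$, where $\rho=|1-\lambda^m|^{1/m}/a$. If in addition the supremum $a$ is attained, or $f$ diverges at every point of $S_{1/a}(0)$, then $D_\rho(0)\subseteq\Delta_f\subseteq D_{1/a}(0)$. These estimates are maximal in the following sense. For every $K$ and $\lambda$ as above there is a polynomial $f\in K[x]$ of the above form such that: in case 1, $f$ has a periodic point in $K$ on the sphere $S_{1/a}(0)$, and $\Delta_f=D_{1/a}(0)$; in case 2, $f$ has a periodic point in $K$ on the sphere $S_\rho(0)$, and $\Delta_f=D_\rho(0)$. -/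

import Mathlib

open scoped ENNReal PowerSeries

namespace UltrametricLinearization

noncomputable section

section Residue

/-- The ring of integers `{x : ‖x‖ ≤ 1}` of an ultrametric normed field. -/
abbrev RingOfIntegers (K : Type*) [NontriviallyNormedField K] [IsUltrametricDist K] :
    ValuationSubring K :=
  (NormedField.valuation (K := K)).valuationSubring

theorem mem_ringOfIntegers {K : Type*} [NontriviallyNormedField K] [IsUltrametricDist K]
    {x : K} : x ∈ RingOfIntegers K ↔ ‖x‖ ≤ 1 := by
  rw [Valuation.mem_valuationSubring_iff, NormedField.valuation_apply, ← NNReal.coe_le_coe]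
  rfl

/-- The residue field, i.e. the ring of integers modulo its maximal ideal. -/
abbrev ResidueField (K : Type*) [NontriviallyNormedField K] [IsUltrametricDist K] : Type _ :=
  IsLocalRing.ResidueField (RingOfIntegers K)

/-- The residue class of an element of the ring of integers. -/
def residue {K : Type*} [NontriviallyNormedField K] [IsUltrametricDist K]
    (x : K) (hx : ‖x‖ ≤ 1) : ResidueField K :=
  IsLocalRing.residue (RingOfIntegers K) ⟨x, mem_ringOfIntegers.mpr hx⟩

end Residue

section Series

variable {K : Type*} [NontriviallyNormedField K]

/-- The power series `f = ∑ a_i X^i` converges at the point `x`. (In a complete ultrametric field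
a series converges if and only if it is summable, if and only if its terms tend to `0`.) -/
def ConvergesAt (f : K⟦X⟧) (x : K) : Prop :=
  Summable fun i : ℕ => PowerSeries.coeff i f * x ^ i

/-- The value `f(x)` of the power series `f` at a point `x` where it converges. -/
def evalAt (f : K⟦X⟧) (x : K) : K :=
  ∑' i : ℕ, PowerSeries.coeff i f * x ^ i

/-- The quantity `|a_i|^{1/(i-1)}`, for `i ≥ 2`. -/
def coeffRoot (f : K⟦X⟧) (i : ℕ) : ℝ≥0∞ :=
  ‖PowerSeries.coeff i f‖ₑ ^ (1 / ((i : ℝ) - 1))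

/-- `a = sup_{i ≥ 2} |a_i|^{1/(i-1)}`, as an element of `[0, ∞]`. -/
def supCoeff (f : K⟦X⟧) : ℝ≥0∞ :=
  ⨆ (i : ℕ) (_ : 2 ≤ i), coeffRoot f i

/-- The supremum `a = sup_{i ≥ 2} |a_i|^{1/(i-1)}` is attained. -/
def SupAttained (f : K⟦X⟧) : Prop :=
  ∃ i : ℕ, 2 ≤ i ∧ coeffRoot f i = supCoeff f

/-- `f` diverges on the sphere of radius `r` about the origin. -/
def DivergesOnSphere (f : K⟦X⟧) (r : ℝ≥0∞) : Prop :=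
  ∀ x : K, ‖x‖ₑ = r → ¬ ConvergesAt f x

/-- The power series `f = lam * X + ∑_{i ≥ 2} a_i X^i` for which
`sup_{i ≥ 2} |a_i|^{1/(i-1)}` is a real number. -/
structure IsInFamily (lam : K) (f : K⟦X⟧) : Prop where
  coeff_zero : PowerSeries.coeff 0 f = 0
  coeff_one : PowerSeries.coeff 1 f = lam
  supCoeff_ne_top : supCoeff f ≠ ∞

/-- `g = X + ∑_{k ≥ 2} b_k X^k` is a formal solution of the Schröder functional equation
`g ∘ f = lam * g`, where `lam = f'(0)`. -/
structure IsFormalConjugacy (f g : K⟦X⟧) : Prop where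
  coeff_zero : PowerSeries.coeff 0 g = 0
  coeff_one : PowerSeries.coeff 1 g = 1
  schroder : PowerSeries.subst f g = PowerSeries.C (PowerSeries.coeff 1 f) * g

/-- Open and closed discs about the origin, of radius `0 < r ≤ ∞`. -/
def IsDisc (U : Set K) : Prop :=
  ∃ r : ℝ≥0∞, 0 < r ∧ (U = Metric.eball 0 r ∨ U = Metric.closedEBall 0 r)

/-- `g(f(x)) = lam * g(x)` holds (all the series involved being convergent) for all `x` in `U`,
and `g` is one-to-one on `U`. -/
structure LinearizesOn (f g : K⟦X⟧) (U : Set K) : Prop where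
  converges_f : ∀ x ∈ U, ConvergesAt f x
  converges_g : ∀ x ∈ U, ConvergesAt g x
  converges_g_f : ∀ x ∈ U, ConvergesAt g (evalAt f x)
  schroder : ∀ x ∈ U, evalAt g (evalAt f x) = PowerSeries.coeff 1 f * evalAt g x
  injOn : Set.InjOn (evalAt g) U

/-- `Δ` is the linearization disc of `f` about the origin: the largest disc on which the
formal conjugacy `g` converges, satisfies the Schröder functional equation and is one-to-one. -/
def IsLinearizationDisc (f : K⟦X⟧) (Δ : Set K) : Prop :=
  ∃ g : K⟦X⟧, IsFormalConjugacy f g ∧ IsGreatest {U : Set K | IsDisc U ∧ LinearizesOn f g U} Δ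

/-- The radius `ρ = |1 - lam^m|^{1/m} / a`. -/
def rho (lam : K) (m : ℕ) (f : K⟦X⟧) : ℝ≥0∞ :=
  ‖1 - lam ^ m‖ₑ ^ (1 / (m : ℝ)) / supCoeff f

end Series

end

end UltrametricLinearization

namespace UltrametricLinearization

/-! Inner bound. Comparing coefficients in the Schröder equation determines `g` recursively, with
divisors `lam - lam ^ n`. Writing `f ^ d = X ^ d * (f / X) ^ d` bounds the numerators by powers of
`a`. If the residue class of `lam` has order `m`, the divisor `1 - lam ^ k` is a unit unless `m ∣
k`, and then has norm `|1 - lam ^ m|` because the residue characteristic is zero. Hence `|b_{k+1}| ≤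
a ^ k * |1 - lam ^ m| ^ (-(k / m))` with integer division `k / m` (`norm_coeff_conjugacy_le`). On
the resulting disc the linear term of `g` dominates, which gives convergence and injectivity; in
case 1 there are no small divisors at all.

Outer bound (`norm_coeff_mul_pow_lt`). If the equation holds on the closed disc of radius `|c|`,
rescale `f` and `g` to have maximal coefficient of norm 1 and reduce. Convergence makes the
reductions polynomials, and the equation becomes `G ∘ F = C * H` over the residue field. A nonlinear
term of `f` as large as the linear one would contradict the degrees. This gives `|a_i| |c| ^ (i - 1)
< 1` for all `i ≥ 2`, hence both outer inclusions. The greatest disc is a union of nested discs.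

Sharpness. Interpolation gives a polynomial with the cycle `1, lam, ..., lam ^ k`. On a cycle the
equation forces `g(1) = 0 = g(0)`, so an injective `g` excludes the point 1. -/

theorem exists_norm_le_norm {E : Type*} [NormedAddCommGroup E] {h : ℕ → E} (hh : Filter.Tendsto h Filter.atTop (nhds 0)) :
    ∃ i, ∀ j, ‖h j‖ ≤ ‖h i‖ := by
  by_cases h0 : ∀ j, h j = 0
  · exact ⟨0, fun j => by simp [h0]⟩
  push Not at h0
  obtain ⟨i, hi⟩ := h0
  have h1 := (hh.norm).eventually_lt_const (u := ‖h i‖) (by simpa using hi)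
  obtain ⟨N, hN⟩ := Filter.eventually_atTop.mp h1
  obtain ⟨k, -, hk⟩ := Finset.exists_max_image (insert i (Finset.range N)) (fun j => ‖h j‖)
    ⟨i, Finset.mem_insert_self _ _⟩
  refine ⟨k, fun j => ?_⟩
  by_cases hj : j < N
  · exact hk j (by simp [hj])
  · exact (hN j (not_lt.mp hj)).le.trans (hk i (Finset.mem_insert_self _ _))

/-! ### Reduction to the residue field and the norms of the small divisors. -/

section Reduction

variable {K : Type*} [NontriviallyNormedField K] [IsUltrametricDist K]

theorem residue_eq_zero_iff {x : K} (hx : ‖x‖ ≤ 1) : residue x hx = 0 ↔ ‖x‖ < 1 := by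
  rw [residue, IsLocalRing.residue_eq_zero_iff, IsLocalRing.mem_maximalIdeal, mem_nonunits_iff]
  constructor
  · intro h
    refine lt_of_le_of_ne hx fun h1 => h ?_
    have hx0 : x ≠ 0 := by
      rintro rfl
      simp at h1
    refine IsUnit.of_mul_eq_one ⟨x⁻¹, mem_ringOfIntegers.mpr (by rw [norm_inv, h1, inv_one])⟩ ?_
    exact Subtype.ext (mul_inv_cancel₀ hx0)
  · intro h hu
    obtain ⟨y, hy⟩ := hu.exists_right_inv
    have h1 : x * (y : K) = 1 := congrArg Subtype.val hy
    have h2 : ‖(y : K)‖ ≤ 1 := mem_ringOfIntegers.mp y.2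
    have h3 : ‖x‖ * ‖(y : K)‖ = 1 := by rw [← norm_mul, h1, norm_one]
    nlinarith [norm_nonneg x, norm_nonneg (y : K)]

open Classical in
/-- The residue class of `x` if `x` is integral, and `0` otherwise. -/
noncomputable def reduce (x : K) : ResidueField K :=
  if hx : ‖x‖ ≤ 1 then residue x hx else 0

theorem reduce_of_le {x : K} (hx : ‖x‖ ≤ 1) : reduce x = residue x hx := dif_pos hx

theorem reduce_zero : reduce (0 : K) = 0 := by
  rw [reduce_of_le (by simp), residue_eq_zero_iff]
  simp

theorem reduce_one : reduce (1 : K) = 1 := by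
  rw [reduce_of_le (by simp)]
  exact map_one (IsLocalRing.residue (RingOfIntegers K))

theorem reduce_mul {x y : K} (hx : ‖x‖ ≤ 1) (hy : ‖y‖ ≤ 1) :
    reduce (x * y) = reduce x * reduce y := by
  have hxy : ‖x * y‖ ≤ 1 := by
    rw [norm_mul]
    exact mul_le_one₀ hx (norm_nonneg _) hy
  rw [reduce_of_le hx, reduce_of_le hy, reduce_of_le hxy]
  exact map_mul (IsLocalRing.residue (RingOfIntegers K))
    ⟨x, mem_ringOfIntegers.mpr hx⟩ ⟨y, mem_ringOfIntegers.mpr hy⟩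

theorem norm_add_le_one {x y : K} (hx : ‖x‖ ≤ 1) (hy : ‖y‖ ≤ 1) : ‖x + y‖ ≤ 1 :=
  (IsUltrametricDist.norm_add_le_max x y).trans (max_le hx hy)

theorem norm_sub_le_max' (x y : K) : ‖x - y‖ ≤ max ‖x‖ ‖y‖ := by
  simpa [sub_eq_add_neg] using IsUltrametricDist.norm_add_le_max x (-y)

theorem reduce_add {x y : K} (hx : ‖x‖ ≤ 1) (hy : ‖y‖ ≤ 1) :
    reduce (x + y) = reduce x + reduce y := by
  rw [reduce_of_le hx, reduce_of_le hy, reduce_of_le (norm_add_le_one hx hy)]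
  exact map_add (IsLocalRing.residue (RingOfIntegers K))
    ⟨x, mem_ringOfIntegers.mpr hx⟩ ⟨y, mem_ringOfIntegers.mpr hy⟩

theorem reduce_eq_zero_iff {x : K} (hx : ‖x‖ ≤ 1) : reduce x = 0 ↔ ‖x‖ < 1 := by
  rw [reduce_of_le hx, residue_eq_zero_iff]

theorem reduce_pow {x : K} (hx : ‖x‖ ≤ 1) (n : ℕ) : reduce (x ^ n) = reduce x ^ n := by
  induction n with
  | zero => simp [reduce_one]
  | succ n ih =>
    rw [pow_succ, pow_succ, reduce_mul _ hx, ih]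
    rw [norm_pow]
    exact pow_le_one₀ (norm_nonneg _) hx

theorem reduce_natCast (n : ℕ) : reduce (n : K) = n := by
  induction n with
  | zero => simp [reduce_zero]
  | succ n ih =>
    push_cast
    rw [reduce_add (IsUltrametricDist.norm_natCast_le_one K n) (by simp), ih, reduce_one]

theorem norm_sum_le_one {ι : Type*} (s : Finset ι) {x : ι → K} (hx : ∀ i, ‖x i‖ ≤ 1) :
    ‖∑ i ∈ s, x i‖ ≤ 1 :=
  IsUltrametricDist.norm_sum_le_of_forall_le_of_nonneg zero_le_one fun i _ => hx i

theorem reduce_sum {ι : Type*} (s : Finset ι) {x : ι → K} (hx : ∀ i, ‖x i‖ ≤ 1) :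
    reduce (∑ i ∈ s, x i) = ∑ i ∈ s, reduce (x i) := by
  classical
  induction s using Finset.induction_on with
  | empty => simp [reduce_zero]
  | insert j s hj ih =>
    rw [Finset.sum_insert hj, Finset.sum_insert hj, reduce_add (hx j) (norm_sum_le_one s hx), ih]

theorem norm_one_sub_pow_le_one {lam : K} (hlam : ‖lam‖ = 1) (n : ℕ) : ‖1 - lam ^ n‖ ≤ 1 :=
  (norm_sub_le_max' _ _).trans (by simp [hlam])

theorem residue_pow_eq_one_iff {lam : K} (hlam : ‖lam‖ = 1) (n : ℕ) :
    residue lam hlam.le ^ n = 1 ↔ ‖1 - lam ^ n‖ < 1 := by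
  have hp : ‖lam ^ n‖ ≤ 1 := by simp [hlam]
  rw [← reduce_eq_zero_iff (norm_one_sub_pow_le_one hlam n), ← reduce_of_le,
    ← reduce_pow hlam.le]
  have h : reduce (1 : K) = reduce (1 - lam ^ n) + reduce (lam ^ n) := by
    rw [← reduce_add (norm_one_sub_pow_le_one hlam n) hp, sub_add_cancel]
  rw [reduce_one] at h
  constructor
  · intro h1
    rw [h1] at h
    simpa using h
  · intro h1
    rw [h1, zero_add] at h
    exact h.symm

theorem isOfFinOrder_residue_iff {lam : K} (hlam : ‖lam‖ = 1) :
    IsOfFinOrder (residue lam hlam.le) ↔ ∃ n : ℕ, 1 ≤ n ∧ ‖1 - lam ^ n‖ < 1 := by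
  rw [isOfFinOrder_iff_pow_eq_one]
  exact exists_congr fun n => and_congr Iff.rfl (residue_pow_eq_one_iff hlam n)

/-- In residue characteristic zero, `|1 - μ ^ q| = |1 - μ|` if `|1 - μ| < 1`. -/
theorem norm_one_sub_pow_eq [CharZero (ResidueField K)] {μ : K} (hμ : ‖μ‖ = 1)
    (h : ‖1 - μ‖ < 1) {q : ℕ} (hq : q ≠ 0) : ‖1 - μ ^ q‖ = ‖1 - μ‖ := by
  have hr : reduce μ = 1 := by
    have := (residue_pow_eq_one_iff hμ 1).mpr (by simpa using h)
    rwa [pow_one, ← reduce_of_le] at this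
  have hle : ∀ i, ‖μ ^ i‖ ≤ 1 := by simp [hμ]
  -- The cofactor `1 + μ + ... + μ ^ (q - 1)` reduces to `q`, which is nonzero in residue
  -- characteristic zero.
  have hs : ‖∑ i ∈ Finset.range q, μ ^ i‖ = 1 := by
    refine le_antisymm (norm_sum_le_one _ hle) (not_lt.mp fun h1 => hq ?_)
    rw [← reduce_eq_zero_iff (norm_sum_le_one _ hle), reduce_sum _ hle] at h1
    simp only [reduce_pow hμ.le, hr, one_pow, Finset.sum_const, Finset.card_range, nsmul_eq_mul,
      mul_one] at h1
    exact_mod_cast h1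
  rw [← mul_neg_geom_sum, norm_mul, hs, mul_one]

/-- The residue class of `lam` has order `m`, so a smaller divisor at `n` would produce one at `n %
m`, against minimality. -/
theorem norm_one_sub_pow_of_not_dvd {lam : K} (hlam : ‖lam‖ = 1) {m : ℕ}
    (hm : IsLeast {n : ℕ | 1 ≤ n ∧ ‖1 - lam ^ n‖ < 1} m) {n : ℕ} (hn : ¬ m ∣ n) :
    ‖1 - lam ^ n‖ = 1 := by
  refine le_antisymm (norm_one_sub_pow_le_one hlam n) (not_lt.mp fun h => ?_)
  have h0 : n % m ≠ 0 := fun h0 => hn (Nat.dvd_of_mod_eq_zero h0)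
  have h1 := (residue_pow_eq_one_iff hlam n).mpr h
  have h2 := (residue_pow_eq_one_iff hlam m).mpr hm.1.2
  rw [← Nat.div_add_mod n m, pow_add, pow_mul, h2, one_pow, one_mul] at h1
  have h3 := hm.2 ⟨Nat.one_le_iff_ne_zero.mpr h0, (residue_pow_eq_one_iff hlam _).mp h1⟩
  exact absurd (Nat.mod_lt n hm.1.1) (not_lt.mpr h3)

theorem norm_one_sub_pow_of_dvd [CharZero (ResidueField K)] {lam : K} (hlam : ‖lam‖ = 1) {m : ℕ}
    (hm : ‖1 - lam ^ m‖ < 1) {n : ℕ} (hn : n ≠ 0) (hmn : m ∣ n) :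
    ‖1 - lam ^ n‖ = ‖1 - lam ^ m‖ := by
  obtain ⟨q, rfl⟩ := hmn
  rw [pow_mul]
  exact norm_one_sub_pow_eq (by simp [hlam]) hm (by rintro rfl; simp at hn)

/-- The reduction of a power series with integral coefficients tending to zero is a polynomial
over the residue field, and reduction is compatible with evaluation. -/
theorem exists_reduction [CompleteSpace K] {h : ℕ → K} (h1 : ∀ i, ‖h i‖ ≤ 1)
    (hh : Filter.Tendsto h Filter.atTop (nhds 0)) :
    ∃ P : Polynomial (ResidueField K), (∀ i, P.coeff i = reduce (h i)) ∧
      ∀ z : K, ‖z‖ ≤ 1 → reduce (∑' i, h i * z ^ i) = P.eval (reduce z) := by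
  -- Any constant below 1 would serve. A uniform bound is needed so that the whole tail of the
  -- series, and not only each of its terms, has norm less than 1.
  obtain ⟨N, hN⟩ := Filter.eventually_atTop.mp
    ((hh.norm).eventually_lt_const (u := 1 / 2) (by simp))
  have hco : ∀ i, N ≤ i → reduce (h i) = 0 := fun i hi =>
    (reduce_eq_zero_iff (h1 i)).mpr ((hN i hi).trans (by norm_num))
  refine ⟨∑ i ∈ Finset.range N, Polynomial.monomial i (reduce (h i)), fun i => ?_, fun z hz => ?_⟩
  · rw [Polynomial.finsetSum_coeff]
    simp only [Polynomial.coeff_monomial, Finset.sum_ite_eq', Finset.mem_range]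
    split_ifs with hi
    · rfl
    · exact (hco i (not_lt.mp hi)).symm
  · have hzp : ∀ i, ‖z ^ i‖ ≤ 1 := fun i => by
      rw [norm_pow]
      exact pow_le_one₀ (norm_nonneg _) hz
    have hle : ∀ i, ‖h i * z ^ i‖ ≤ ‖h i‖ := fun i => by
      rw [norm_mul]
      exact mul_le_of_le_one_right (norm_nonneg _) (hzp i)
    have hle1 : ∀ i, ‖h i * z ^ i‖ ≤ 1 := fun i => (hle i).trans (h1 i)
    have hsum : Summable fun i => h i * z ^ i := by
      refine NonarchimedeanAddGroup.summable_of_tendsto_cofinite_zero ?_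
      rw [Nat.cofinite_eq_atTop]
      exact squeeze_zero_norm hle (by simpa using hh.norm)
    have htail : ‖∑' i, h (i + N) * z ^ (i + N)‖ < 1 := by
      refine lt_of_le_of_lt (IsUltrametricDist.norm_tsum_le_of_forall_le_of_nonneg
        (C := 1 / 2) (by norm_num) fun i => ?_) (by norm_num)
      exact (hle _).trans (hN _ (by omega)).le
    rw [← hsum.sum_add_tsum_nat_add N, reduce_add (norm_sum_le_one _ hle1) htail.le,
      (reduce_eq_zero_iff htail.le).mpr htail, add_zero, reduce_sum _ hle1,
      Polynomial.eval_finsetSum]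
    refine Finset.sum_congr rfl fun i _ => ?_
    rw [Polynomial.eval_monomial, reduce_mul (h1 i) (hzp i), reduce_pow hz]

end Reduction

end UltrametricLinearization
namespace UltrametricLinearization

/-! ### The formal conjugacy and the estimate of its coefficients. -/

section Formal

variable {K : Type*} [NontriviallyNormedField K]

/-- The power series `f / X` (after dropping the constant term of `f`). -/
noncomputable def divX (f : K⟦X⟧) : K⟦X⟧ :=
  PowerSeries.mk fun i => PowerSeries.coeff (i + 1) f

theorem coeff_divX (f : K⟦X⟧) (i : ℕ) :
    PowerSeries.coeff i (divX f) = PowerSeries.coeff (i + 1) f :=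
  PowerSeries.coeff_mk _ _

theorem X_mul_divX {f : K⟦X⟧} (hf : PowerSeries.coeff 0 f = 0) : PowerSeries.X * divX f = f := by
  ext i
  cases i with
  | zero => simpa using hf.symm
  | succ i => rw [PowerSeries.coeff_succ_X_mul, coeff_divX]

/-- Extracting `X ^ d` lowers the index by `d`. This shift is what makes the powers of `a` add up to
the right exponent in the coefficient estimate. -/
theorem coeff_pow_eq {f : K⟦X⟧} (hf : PowerSeries.coeff 0 f = 0) (n d : ℕ) :
    PowerSeries.coeff n (f ^ d) =
      if d ≤ n then PowerSeries.coeff (n - d) (divX f ^ d) else 0 := by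
  conv_lhs => rw [← X_mul_divX hf, mul_pow, PowerSeries.coeff_X_pow_mul']

theorem coeff_pow_self {f : K⟦X⟧} (hf : PowerSeries.coeff 0 f = 0) (n : ℕ) :
    PowerSeries.coeff n (f ^ n) = PowerSeries.coeff 1 f ^ n := by
  rw [coeff_pow_eq hf, if_pos le_rfl, Nat.sub_self, PowerSeries.coeff_zero_eq_constantCoeff_apply,
    map_pow, ← PowerSeries.coeff_zero_eq_constantCoeff_apply, coeff_divX]

theorem coeff_subst_eq_sum {f : K⟦X⟧} (hf : PowerSeries.coeff 0 f = 0) (g : K⟦X⟧) (n : ℕ) :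
    PowerSeries.coeff n (PowerSeries.subst f g) =
      ∑ d ∈ Finset.range (n + 1), PowerSeries.coeff d g * PowerSeries.coeff n (f ^ d) := by
  rw [PowerSeries.coeff_subst' (PowerSeries.HasSubst.of_constantCoeff_zero'
    (by simpa using hf))]
  simp only [smul_eq_mul]
  refine finsum_eq_sum_of_support_subset _ fun d hd => ?_
  rw [Function.mem_support] at hd
  by_contra h
  refine hd ?_
  rw [coeff_pow_eq hf, if_neg (by simpa using h), mul_zero]

/-- The term `d = n` of the substitution is `lam ^ n * b_n`. Moved to the other side it leaves a
recursion whose divisor `lam - lam ^ n` vanishes, for `lam` nonzero and not a root of unity, only at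
`n = 1` among positive `n`. -/
theorem isFormalConjugacy_iff {f : K⟦X⟧} (hf : PowerSeries.coeff 0 f = 0) (g : K⟦X⟧) :
    IsFormalConjugacy f g ↔ PowerSeries.coeff 0 g = 0 ∧ PowerSeries.coeff 1 g = 1 ∧
      ∀ n, ∑ d ∈ Finset.range n, PowerSeries.coeff d g * PowerSeries.coeff n (f ^ d) =
        (PowerSeries.coeff 1 f - PowerSeries.coeff 1 f ^ n) * PowerSeries.coeff n g := by
  have key : PowerSeries.subst f g = PowerSeries.C (PowerSeries.coeff 1 f) * g ↔
      ∀ n, ∑ d ∈ Finset.range n, PowerSeries.coeff d g * PowerSeries.coeff n (f ^ d) =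
        (PowerSeries.coeff 1 f - PowerSeries.coeff 1 f ^ n) * PowerSeries.coeff n g := by
    rw [PowerSeries.ext_iff]
    refine forall_congr' fun n => ?_
    rw [coeff_subst_eq_sum hf, Finset.sum_range_succ, coeff_pow_self hf, PowerSeries.coeff_C_mul,
      ← eq_sub_iff_add_eq, sub_mul, mul_comm (PowerSeries.coeff n g)]
  exact ⟨fun h => ⟨h.1, h.2, key.mp h.3⟩, fun h => ⟨h.1, h.2.1, key.mpr h.2.2⟩⟩

/-- The coefficients of the formal solution of the Schröder functional equation. -/
noncomputable def conjugacyCoeff (f : K⟦X⟧) : ℕ → K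
  | 0 => 0
  | 1 => 1
  | n + 2 => (PowerSeries.coeff 1 f - PowerSeries.coeff 1 f ^ (n + 2))⁻¹ *
      ∑ d : Fin (n + 2), conjugacyCoeff f d * PowerSeries.coeff (n + 2) (f ^ (d : ℕ))

theorem self_sub_pow_ne_zero {lam : K} (h0 : lam ≠ 0) (hroot : ∀ n : ℕ, 1 ≤ n → lam ^ n ≠ 1)
    (n : ℕ) : lam - lam ^ (n + 2) ≠ 0 := by
  rw [show lam - lam ^ (n + 2) = lam * (1 - lam ^ (n + 1)) by ring]
  exact mul_ne_zero h0 (sub_ne_zero.mpr (hroot (n + 1) (by omega)).symm)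

theorem existsUnique_isFormalConjugacy {lam : K} (h0 : lam ≠ 0)
    (hroot : ∀ n : ℕ, 1 ≤ n → lam ^ n ≠ 1) {f : K⟦X⟧} (hf0 : PowerSeries.coeff 0 f = 0)
    (hf1 : PowerSeries.coeff 1 f = lam) : ∃! g : K⟦X⟧, IsFormalConjugacy f g := by
  refine ⟨PowerSeries.mk (conjugacyCoeff f), ?_, fun g hg => ?_⟩
  · refine (isFormalConjugacy_iff hf0 _).mpr ⟨?_, ?_, fun n => ?_⟩
    · simp [conjugacyCoeff]
    · simp [conjugacyCoeff]
    · simp only [PowerSeries.coeff_mk]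
      match n with
      | 0 => simp [conjugacyCoeff]
      | 1 => simp [conjugacyCoeff]
      | n + 2 =>
        rw [conjugacyCoeff, mul_inv_cancel_left₀ (by
          rw [hf1]
          exact self_sub_pow_ne_zero h0 hroot n), Fin.sum_univ_eq_sum_range
          (fun d => conjugacyCoeff f d * PowerSeries.coeff (n + 2) (f ^ d))]
  · obtain ⟨hg0, hg1, hg⟩ := (isFormalConjugacy_iff hf0 _).mp hg
    ext n
    rw [PowerSeries.coeff_mk]
    induction n using Nat.strong_induction_on with
    | _ n ih =>
      match n with
      | 0 => simpa [conjugacyCoeff] using hg0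
      | 1 => simpa [conjugacyCoeff] using hg1
      | n + 2 =>
        rw [conjugacyCoeff, Fin.sum_univ_eq_sum_range
          (fun d => conjugacyCoeff f d * PowerSeries.coeff (n + 2) (f ^ d)),
          eq_inv_mul_iff_mul_eq₀ (by
            rw [hf1]
            exact self_sub_pow_ne_zero h0 hroot n), ← hg]
        exact Finset.sum_congr rfl fun d hd => by rw [ih d (Finset.mem_range.mp hd)]

variable [IsUltrametricDist K]

theorem norm_coeff_mul_le {p q : K⟦X⟧} {a : ℝ} (ha : 0 ≤ a)
    (hp : ∀ i, ‖PowerSeries.coeff i p‖ ≤ a ^ i) (hq : ∀ i, ‖PowerSeries.coeff i q‖ ≤ a ^ i)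
    (i : ℕ) : ‖PowerSeries.coeff i (p * q)‖ ≤ a ^ i := by
  rw [PowerSeries.coeff_mul]
  refine IsUltrametricDist.norm_sum_le_of_forall_le_of_nonneg (pow_nonneg ha i) fun x hx => ?_
  rw [← Finset.HasAntidiagonal.mem_antidiagonal.mp hx, pow_add, norm_mul]
  exact mul_le_mul (hp _) (hq _) (norm_nonneg _) (pow_nonneg ha _)

theorem norm_coeff_pow_le {p : K⟦X⟧} {a : ℝ} (ha : 0 ≤ a)
    (hp : ∀ i, ‖PowerSeries.coeff i p‖ ≤ a ^ i) (d i : ℕ) :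
    ‖PowerSeries.coeff i (p ^ d)‖ ≤ a ^ i := by
  induction d generalizing i with
  | zero =>
    rw [pow_zero, PowerSeries.coeff_one]
    split_ifs with h
    · simp [h]
    · simpa using pow_nonneg ha i
  | succ d ih =>
    rw [pow_succ]
    exact norm_coeff_mul_le ha ih hp i

/-- Estimate of the coefficients of the conjugacy. The number `t ^ m` bounds the small divisors,
which occur only at multiples of `m`. -/
theorem norm_coeff_conjugacy_le {f g : K⟦X⟧} {a t : ℝ} (ha : 0 ≤ a) (ht : 1 ≤ t) {m : ℕ}
    (hm : m ≠ 0) (hf0 : PowerSeries.coeff 0 f = 0) (hf1 : ‖PowerSeries.coeff 1 f‖ = 1)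
    (hf : ∀ i, ‖PowerSeries.coeff (i + 1) f‖ ≤ a ^ i) (hg : IsFormalConjugacy f g)
    (hdvd : ∀ n, n ≠ 0 → m ∣ n → 1 ≤ t ^ m * ‖1 - PowerSeries.coeff 1 f ^ n‖)
    (hndvd : ∀ n, ¬ m ∣ n → 1 ≤ ‖1 - PowerSeries.coeff 1 f ^ n‖) (k : ℕ) :
    ‖PowerSeries.coeff (k + 1) g‖ ≤ (a * t) ^ k := by
  obtain ⟨hg0, hg1, hgs⟩ := (isFormalConjugacy_iff hf0 g).mp hg
  have ht0 : 0 ≤ t := zero_le_one.trans ht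
  have hpos : ∀ i j : ℕ, 0 ≤ a ^ i * t ^ j := fun i j =>
    mul_nonneg (pow_nonneg ha i) (pow_nonneg ht0 j)
  -- The induction needs the exponent rounded down to a multiple of `m`: a factor `t ^ m` is spent
  -- only when `k` passes such a multiple. The bound `t ^ k` is a weakening made at the end.
  have main : ∀ k, ‖PowerSeries.coeff (k + 1) g‖ ≤ a ^ k * t ^ (m * (k / m)) := by
    intro k
    induction k using Nat.strong_induction_on with
    | _ k ih =>
    rcases Nat.eq_zero_or_pos k with rfl | hk
    · simp [hg1]
    have hk1 := congrArg norm (hgs (k + 1))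
    rw [show PowerSeries.coeff 1 f - PowerSeries.coeff 1 f ^ (k + 1) =
      PowerSeries.coeff 1 f * (1 - PowerSeries.coeff 1 f ^ k) by ring, norm_mul, norm_mul, hf1,
      one_mul, Finset.sum_range_succ', hg0, zero_mul, add_zero] at hk1
    have hsum : ∀ e, (∀ j < k, m * (j / m) ≤ e) →
        ‖1 - PowerSeries.coeff 1 f ^ k‖ * ‖PowerSeries.coeff (k + 1) g‖ ≤ a ^ k * t ^ e := by
      intro e he
      rw [← hk1]
      refine IsUltrametricDist.norm_sum_le_of_forall_le_of_nonneg (hpos _ _) fun j hj => ?_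
      have hjk := Finset.mem_range.mp hj
      rw [norm_mul, coeff_pow_eq hf0, if_pos (by omega)]
      calc _ ≤ (a ^ j * t ^ (m * (j / m))) * a ^ (k + 1 - (j + 1)) :=
            mul_le_mul (ih j hjk) (norm_coeff_pow_le ha (fun i => by
              rw [coeff_divX]
              exact hf i) _ _) (norm_nonneg _) (hpos _ _)
        _ = a ^ k * t ^ (m * (j / m)) := by
            rw [mul_right_comm, ← pow_add]
            congr 2
            omega
        _ ≤ a ^ k * t ^ e :=
            mul_le_mul_of_nonneg_left (pow_le_pow_right₀ ht (he j hjk)) (pow_nonneg ha k)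
    by_cases hmk : m ∣ k
    · obtain ⟨q, rfl⟩ := hmk
      have hq : q ≠ 0 := by
        rintro rfl
        simp at hk
      obtain ⟨q, rfl⟩ := Nat.exists_eq_succ_of_ne_zero hq
      -- Every earlier index has spent at most `q` factors `t ^ m`, so the next one is available for
      -- the divisor at `m * (q + 1)`.
      have h1 := hsum (m * q) fun j hj =>
        Nat.mul_le_mul_left m (Nat.lt_succ_iff.mp (Nat.div_lt_of_lt_mul hj))
      rw [Nat.mul_div_cancel_left _ (Nat.pos_of_ne_zero hm)]
      calc _ ≤ (t ^ m * ‖1 - PowerSeries.coeff 1 f ^ (m * q.succ)‖) *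
              ‖PowerSeries.coeff (m * q.succ + 1) g‖ :=
            le_mul_of_one_le_left (norm_nonneg _) (hdvd _ hk.ne' (Dvd.intro _ rfl))
        _ ≤ t ^ m * (a ^ (m * q.succ) * t ^ (m * q)) := by
            rw [mul_assoc]
            exact mul_le_mul_of_nonneg_left h1 (pow_nonneg ht0 m)
        _ = a ^ (m * q.succ) * t ^ (m * q.succ) := by
            rw [mul_left_comm, ← pow_add, Nat.mul_succ, add_comm m]
    · exact (le_mul_of_one_le_left (norm_nonneg _) (hndvd k hmk)).trans
        (hsum _ fun j hj => Nat.mul_le_mul_left m (Nat.div_le_div_right hj.le))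
  refine (main k).trans ?_
  rw [mul_pow]
  exact mul_le_mul_of_nonneg_left (pow_le_pow_right₀ ht (Nat.mul_div_le k m)) (pow_nonneg ha k)

end Formal

end UltrametricLinearization
namespace UltrametricLinearization

/-! ### Convergence, injectivity and composition on discs. -/

section Analytic

variable {K : Type*} [NontriviallyNormedField K]

theorem evalAt_pow [CompleteSpace K] {p : K⟦X⟧} {x : K}
    (hp : Summable fun i => ‖PowerSeries.coeff i p * x ^ i‖) (d : ℕ) :
    (Summable fun i => ‖PowerSeries.coeff i (p ^ d) * x ^ i‖) ∧
      evalAt (p ^ d) x = evalAt p x ^ d := by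
  induction d with
  | zero =>
    have h : ∀ i, i ≠ 0 → PowerSeries.coeff i (1 : K⟦X⟧) * x ^ i = 0 := fun i hi => by
      rw [PowerSeries.coeff_one, if_neg hi, zero_mul]
    refine ⟨?_, ?_⟩
    · rw [pow_zero]
      exact summable_of_ne_finset_zero (s := {0}) fun i hi => by
        rw [h i (by simpa using hi), norm_zero]
    · rw [pow_zero, pow_zero, evalAt, tsum_eq_single 0 h]
      simp
  | succ d ih =>
    have h : ∀ n, PowerSeries.coeff n (p ^ (d + 1)) * x ^ n =
        ∑ kl ∈ Finset.HasAntidiagonal.antidiagonal n, (PowerSeries.coeff kl.1 (p ^ d) * x ^ kl.1) *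
          (PowerSeries.coeff kl.2 p * x ^ kl.2) := by
      intro n
      rw [pow_succ, PowerSeries.coeff_mul, Finset.sum_mul]
      refine Finset.sum_congr rfl fun kl hkl => ?_
      rw [← Finset.HasAntidiagonal.mem_antidiagonal.mp hkl]
      ring
    refine ⟨?_, ?_⟩
    · exact (summable_norm_sum_mul_antidiagonal_of_summable_norm ih.1 hp).congr fun n =>
        congrArg norm (h n).symm
    · rw [pow_succ (evalAt p x), ← ih.2, evalAt, evalAt, evalAt,
        tsum_mul_tsum_eq_tsum_sum_antidiagonal_of_summable_norm ih.1 hp]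
      exact tsum_congr h

theorem convergesAt_of_bound [CompleteSpace K] {f : K⟦X⟧} {s : ℝ} (hs : 0 ≤ s)
    (hf : ∀ i, ‖PowerSeries.coeff (i + 1) f‖ ≤ s ^ i) {x : K} (hx : s * ‖x‖ < 1) :
    ConvergesAt f x := by
  refine (summable_nat_add_iff 1).mp (Summable.of_norm_bounded
    ((summable_geometric_of_lt_one (mul_nonneg hs (norm_nonneg x)) hx).mul_right ‖x‖) fun i => ?_)
  rw [norm_mul, norm_pow, pow_succ, mul_pow, ← mul_assoc]
  gcongr
  exact hf i

theorem evalAt_eq_tsum_succ {f : K⟦X⟧} (hf0 : PowerSeries.coeff 0 f = 0) (x : K) :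
    evalAt f x = ∑' i, PowerSeries.coeff (i + 1) f * x ^ (i + 1) := by
  rw [evalAt]
  by_cases h : Summable fun i => PowerSeries.coeff i f * x ^ i
  · rw [h.tsum_eq_zero_add, hf0, zero_mul, zero_add]
  -- Where the series diverges, both sums take the default value 0.
  · rw [tsum_eq_zero_of_not_summable h, tsum_eq_zero_of_not_summable]
    rwa [summable_nat_add_iff 1 (f := fun i => PowerSeries.coeff i f * x ^ i)]

theorem evalAt_eq_mul_divX {f : K⟦X⟧} (hf0 : PowerSeries.coeff 0 f = 0) (x : K) :
    evalAt f x = x * evalAt (divX f) x := by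
  rw [evalAt_eq_tsum_succ hf0, evalAt, ← tsum_mul_left]
  refine tsum_congr fun i => ?_
  rw [coeff_divX, pow_succ]
  ring

variable [IsUltrametricDist K]

/-- By the ultrametric inequality the linear bound controls the sum, so `f` does not leave the disc
and `g` can be evaluated at `f(x)`. -/
theorem norm_evalAt_le {f : K⟦X⟧} (hf0 : PowerSeries.coeff 0 f = 0) {s : ℝ} (hs : 0 ≤ s)
    (hf : ∀ i, ‖PowerSeries.coeff (i + 1) f‖ ≤ s ^ i) {x : K} (hx : s * ‖x‖ ≤ 1) :
    ‖evalAt f x‖ ≤ ‖x‖ := by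
  rw [evalAt_eq_tsum_succ hf0]
  refine IsUltrametricDist.norm_tsum_le_of_forall_le_of_nonneg (norm_nonneg x) fun i => ?_
  rw [norm_mul, norm_pow, pow_succ, ← mul_assoc]
  refine mul_le_of_le_one_left (norm_nonneg x) ?_
  calc _ ≤ s ^ i * ‖x‖ ^ i := mul_le_mul_of_nonneg_right (hf i) (by positivity)
    _ = (s * ‖x‖) ^ i := (mul_pow _ _ _).symm
    _ ≤ 1 := pow_le_one₀ (by positivity) hx

theorem norm_pow_sub_pow_le (x y : K) (n : ℕ) :
    ‖x ^ (n + 1) - y ^ (n + 1)‖ ≤ max ‖x‖ ‖y‖ ^ n * ‖x - y‖ := by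
  have h0 : 0 ≤ max ‖x‖ ‖y‖ := (norm_nonneg x).trans (le_max_left _ _)
  rw [← (Commute.all x y).geom_sum₂_mul, norm_mul]
  refine mul_le_mul_of_nonneg_right ?_ (norm_nonneg _)
  refine IsUltrametricDist.norm_sum_le_of_forall_le_of_nonneg (pow_nonneg h0 n) fun i hi => ?_
  rw [norm_mul, norm_pow, norm_pow]
  calc _ ≤ max ‖x‖ ‖y‖ ^ i * max ‖x‖ ‖y‖ ^ (n + 1 - 1 - i) := by
        gcongr
        · exact le_max_left _ _
        · exact le_max_right _ _
    _ = max ‖x‖ ‖y‖ ^ n := by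
        rw [← pow_add]
        congr 1
        have := Finset.mem_range.mp hi
        omega

variable [CompleteSpace K]

/-- In `g(x) - g(y)` the nonlinear terms contribute at most `s * max ‖x‖ ‖y‖ * ‖x - y‖`, a factor
below 1 times the linear term `x - y`, so they cannot cancel it. -/
theorem eq_of_evalAt_eq {g : K⟦X⟧} (hg0 : PowerSeries.coeff 0 g = 0)
    (hg1 : PowerSeries.coeff 1 g = 1) {s : ℝ} (hs : 0 ≤ s)
    (hg : ∀ i, ‖PowerSeries.coeff (i + 1) g‖ ≤ s ^ i) {x y : K} (hx : s * ‖x‖ < 1)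
    (hy : s * ‖y‖ < 1) (hxy : evalAt g x = evalAt g y) : x = y := by
  have cx := (summable_nat_add_iff 1).mpr (convergesAt_of_bound hs hg hx)
  have cy := (summable_nat_add_iff 1).mpr (convergesAt_of_bound hs hg hy)
  rw [evalAt_eq_tsum_succ hg0, evalAt_eq_tsum_succ hg0, ← sub_eq_zero, ← cx.tsum_sub cy,
    (cx.sub cy).tsum_eq_zero_add, zero_add, hg1] at hxy
  simp only [pow_one, one_mul] at hxy
  have hM : s * max ‖x‖ ‖y‖ < 1 := by
    rcases max_choice ‖x‖ ‖y‖ with h | h <;> rwa [h]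
  have hM0 : 0 ≤ s * max ‖x‖ ‖y‖ := mul_nonneg hs ((norm_nonneg x).trans (le_max_left _ _))
  have hle : ‖x - y‖ ≤ s * max ‖x‖ ‖y‖ * ‖x - y‖ := by
    refine (congrArg norm (eq_neg_of_add_eq_zero_left hxy)).trans_le ?_
    rw [norm_neg]
    refine IsUltrametricDist.norm_tsum_le_of_forall_le_of_nonneg (by positivity) fun i => ?_
    rw [← mul_sub, norm_mul]
    calc _ ≤ s ^ (i + 1) * (max ‖x‖ ‖y‖ ^ (i + 1) * ‖x - y‖) :=
          mul_le_mul (hg _) (norm_pow_sub_pow_le x y _) (norm_nonneg _) (by positivity)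
      _ = (s * max ‖x‖ ‖y‖) ^ (i + 1) * ‖x - y‖ := by rw [mul_pow, mul_assoc]
      _ ≤ _ := mul_le_mul_of_nonneg_right (pow_le_of_le_one hM0 hM.le (by omega)) (norm_nonneg _)
  have h0 : ‖x - y‖ = 0 := by nlinarith [norm_nonneg (x - y)]
  exact sub_eq_zero.mp (norm_eq_zero.mp h0)

/-- Expanding each power of `f` gives a double series dominated by a product of geometric series.
Summing it by rows gives `g(f(x))`, by antidiagonals the substituted series. -/
theorem evalAt_subst {f g : K⟦X⟧} (hf0 : PowerSeries.coeff 0 f = 0)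
    (hg0 : PowerSeries.coeff 0 g = 0) {s : ℝ} (hs : 0 ≤ s)
    (hf : ∀ i, ‖PowerSeries.coeff (i + 1) f‖ ≤ s ^ i)
    (hg : ∀ i, ‖PowerSeries.coeff (i + 1) g‖ ≤ s ^ i) {x : K} (hx : s * ‖x‖ < 1) :
    evalAt (PowerSeries.subst f g) x = evalAt g (evalAt f x) := by
  have hsx : 0 ≤ s * ‖x‖ := mul_nonneg hs (norm_nonneg x)
  have hgeo := summable_geometric_of_lt_one hsx hx
  have hf' : ∀ i, ‖PowerSeries.coeff i (divX f)‖ ≤ s ^ i := fun i => by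
    rw [coeff_divX]
    exact hf i
  have hconv : Summable fun i => ‖PowerSeries.coeff i (divX f) * x ^ i‖ := by
    refine Summable.of_nonneg_of_le (fun i => norm_nonneg _) (fun i => ?_) hgeo
    rw [norm_mul, norm_pow, mul_pow]
    gcongr
    exact hf' i
  have hsubst0 : PowerSeries.coeff 0 (PowerSeries.subst f g) = 0 := by
    rw [coeff_subst_eq_sum hf0]
    simp [hg0]
  -- The first index is the power of `f` minus one, the second the degree in `f / X`; antidiagonal
  -- `n` thus collects the terms in `x ^ (n + 1)`.
  let F : ℕ × ℕ → K := fun p => PowerSeries.coeff (p.1 + 1) g *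
    (PowerSeries.coeff p.2 (divX f ^ (p.1 + 1)) * x ^ p.2) * x ^ (p.1 + 1)
  have hF : Summable F := by
    refine Summable.of_norm_bounded ((hgeo.mul_of_nonneg hgeo (fun i => pow_nonneg hsx i)
      (fun i => pow_nonneg hsx i)).mul_right ‖x‖) fun p => ?_
    calc ‖F p‖ = ‖PowerSeries.coeff (p.1 + 1) g‖ *
          (‖PowerSeries.coeff p.2 (divX f ^ (p.1 + 1))‖ * ‖x‖ ^ p.2) * ‖x‖ ^ (p.1 + 1) := by
          simp only [F, norm_mul, norm_pow]
      _ ≤ s ^ p.1 * (s ^ p.2 * ‖x‖ ^ p.2) * ‖x‖ ^ (p.1 + 1) := by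
          gcongr
          · exact hg _
          · exact norm_coeff_pow_le hs hf' _ _
      _ = (s * ‖x‖) ^ p.1 * (s * ‖x‖) ^ p.2 * ‖x‖ := by
          rw [mul_pow, mul_pow]
          ring
  have h1 : evalAt g (evalAt f x) = ∑' p, F p := by
    rw [hF.tsum_prod, evalAt_eq_tsum_succ hg0]
    refine tsum_congr fun d => ?_
    simp only [F]
    rw [tsum_mul_right, tsum_mul_left, ← evalAt, (evalAt_pow hconv (d + 1)).2,
      evalAt_eq_mul_divX hf0, mul_pow]
    ring
  rw [h1, evalAt_eq_tsum_succ hsubst0,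
    ← Finset.HasAntidiagonal.sigmaAntidiagonalEquivProd.tsum_eq F]
  refine Eq.trans ?_ (Summable.tsum_sigma' (fun n => (hasSum_fintype _).summable)
    (Finset.HasAntidiagonal.sigmaAntidiagonalEquivProd.summable_iff.mpr hF)).symm
  refine tsum_congr fun n => ?_
  rw [tsum_fintype, coeff_subst_eq_sum hf0, Finset.sum_range_succ', hg0, zero_mul, add_zero,
    Finset.sum_mul]
  refine Eq.trans ?_ (Finset.sum_coe_sort (Finset.HasAntidiagonal.antidiagonal n) F).symm
  rw [Finset.Nat.sum_antidiagonal_eq_sum_range_succ_mk]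
  refine Finset.sum_congr rfl fun d hd => ?_
  have hd' := Finset.mem_range.mp hd
  rw [coeff_pow_eq hf0, if_pos (by omega), Nat.add_sub_add_right,
    show n + 1 = n - d + (d + 1) by omega, pow_add x]
  simp only [F]
  ring

theorem linearizesOn_of_bound {f g : K⟦X⟧} (hf0 : PowerSeries.coeff 0 f = 0)
    (hfg : IsFormalConjugacy f g) {s : ℝ} (hs : 0 ≤ s)
    (hf : ∀ i, ‖PowerSeries.coeff (i + 1) f‖ ≤ s ^ i)
    (hg : ∀ i, ‖PowerSeries.coeff (i + 1) g‖ ≤ s ^ i) {U : Set K}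
    (hU : ∀ x ∈ U, s * ‖x‖ < 1) : LinearizesOn f g U where
  converges_f x hx := convergesAt_of_bound hs hf (hU x hx)
  converges_g x hx := convergesAt_of_bound hs hg (hU x hx)
  converges_g_f x hx := convergesAt_of_bound hs hg
    ((mul_le_mul_of_nonneg_left (norm_evalAt_le hf0 hs hf (hU x hx).le) hs).trans_lt (hU x hx))
  schroder x hx := by
    rw [← evalAt_subst hf0 hfg.1 hs hf hg (hU x hx), hfg.3, evalAt, evalAt, ← tsum_mul_left]
    simp only [PowerSeries.coeff_C_mul, mul_assoc]
  injOn x hx y hy hxy := eq_of_evalAt_eq hfg.1 hfg.2 hs hg (hU x hx) (hU y hy) hxy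

end Analytic

end UltrametricLinearization
namespace UltrametricLinearization

/-! ### The outer bound, by comparing degrees over the residue field. -/

/-- Natural numbers serve as test points: they are infinitely many in the residue field and lift to
integral elements of `K`. -/
theorem polynomial_eq_of_forall_natCast_eval_eq {F : Type*} [Field F] [CharZero F]
    {P Q : Polynomial F} (h : ∀ n : ℕ, P.eval (n : F) = Q.eval (n : F)) : P = Q := by
  refine Polynomial.eq_of_infinite_eval_eq P Q (Set.infinite_of_injective_forall_mem
    (f := fun n : ℕ => (n : F)) Nat.cast_injective h)

section UpperBound

variable {K : Type*} [NontriviallyNormedField K] [IsUltrametricDist K]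

theorem tendsto_coeff_mul_pow {f : K⟦X⟧} {x : K} (h : ConvergesAt f x) {y : K}
    (hy : ‖y‖ ≤ ‖x‖) (e : K) :
    Filter.Tendsto (fun i => PowerSeries.coeff i f * y ^ i / e) Filter.atTop (nhds 0) := by
  have h1 := (h.tendsto_atTop_zero.norm).div_const ‖e‖
  rw [norm_zero, zero_div] at h1
  refine squeeze_zero_norm (fun i => ?_) h1
  rw [norm_div, norm_mul, norm_mul, norm_pow, norm_pow]
  gcongr

theorem reduce_evalAt_div {f : K⟦X⟧} {c e : K} {P : Polynomial (ResidueField K)}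
    (hP : ∀ z : K, ‖z‖ ≤ 1 → reduce (∑' i, PowerSeries.coeff i f * c ^ i / e * z ^ i) =
      P.eval (reduce z)) {z : K} (hz : ‖z‖ ≤ 1) :
    reduce (evalAt f (c * z) / e) = P.eval (reduce z) := by
  rw [← hP z hz, evalAt, ← tsum_div_const]
  congr 1
  refine tsum_congr fun i => ?_
  rw [mul_pow]
  ring

theorem norm_evalAt_le_of_forall {f : K⟦X⟧} {c d : K}
    (h : ∀ i, ‖PowerSeries.coeff i f * c ^ i‖ ≤ ‖d‖) {z : K} (hz : ‖z‖ ≤ 1) :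
    ‖evalAt f (c * z)‖ ≤ ‖d‖ := by
  refine IsUltrametricDist.norm_tsum_le_of_forall_le_of_nonneg (norm_nonneg d) fun i => ?_
  rw [mul_pow, ← mul_assoc, norm_mul, norm_pow]
  exact (mul_le_of_le_one_right (norm_nonneg _) (pow_le_one₀ (norm_nonneg z) hz)).trans (h i)

variable [CompleteSpace K]

/-- If the Schröder equation holds on the closed disc of radius `‖c‖`, then `f` has no nonlinear
term which is as large as the linear term on this disc. -/
theorem norm_coeff_mul_pow_lt [CharZero (ResidueField K)] {f g : K⟦X⟧}
    (hf0 : PowerSeries.coeff 0 f = 0) (hf1 : ‖PowerSeries.coeff 1 f‖ = 1)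
    (hg0 : PowerSeries.coeff 0 g = 0) (hg1 : PowerSeries.coeff 1 g = 1) {U : Set K}
    (hU : LinearizesOn f g U) {c : K} (hc : ∀ z : K, ‖z‖ ≤ 1 → c * z ∈ U) {i : ℕ} (hi : 2 ≤ i)
    (hc0 : c ≠ 0) : ‖PowerSeries.coeff i f * c ^ i‖ < ‖c‖ := by
  by_contra! hlt
  have hcU : c ∈ U := by simpa using hc 1 (by simp)
  have hnat : ∀ n : ℕ, ‖(n : K)‖ ≤ 1 := IsUltrametricDist.norm_natCast_le_one K
  have hfc1 : ‖PowerSeries.coeff 1 f * c ^ 1‖ = ‖c‖ := by rw [pow_one, norm_mul, hf1, one_mul]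
  -- the normalization of `f`
  obtain ⟨d, j, hdj, hdc, hd⟩ : ∃ (d : K) (j : ℕ),
      ‖PowerSeries.coeff j f * c ^ j‖ = ‖d‖ ∧
      ((d = c ∧ 2 ≤ j) ∨ (‖c‖ < ‖d‖ ∧ 1 ≤ j)) ∧
      ∀ k, ‖PowerSeries.coeff k f * c ^ k‖ ≤ ‖d‖ := by
    obtain ⟨j, hj⟩ := exists_norm_le_norm (hU.converges_f c hcU).tendsto_atTop_zero
    rcases (hfc1.ge.trans (hj 1)).eq_or_lt with h | h
    · exact ⟨c, i, le_antisymm (h ▸ hj i) hlt, Or.inl ⟨rfl, hi⟩, fun k => h ▸ hj k⟩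
    · refine ⟨PowerSeries.coeff j f * c ^ j, j, rfl, Or.inr ⟨h, ?_⟩, hj⟩
      by_contra! hj0
      obtain rfl : j = 0 := by omega
      rw [hf0, zero_mul, norm_zero] at h
      exact absurd h (not_lt.mpr (norm_nonneg c))
  have hcd : ‖c‖ ≤ ‖d‖ := by
    rcases hdc with ⟨rfl, -⟩ | ⟨h, -⟩
    · exact le_rfl
    · exact h.le
  have hd0 : 0 < ‖d‖ := (norm_pos_iff.mpr hc0).trans_le hcd
  have hd0' : d ≠ 0 := norm_pos_iff.mp hd0
  have hF1 : ∀ k, ‖PowerSeries.coeff k f * c ^ k / d‖ ≤ 1 := fun k => by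
    rw [norm_div]
    exact div_le_one_of_le₀ (hd k) hd0.le
  obtain ⟨F, hFc, hF⟩ := exists_reduction hF1
    (tendsto_coeff_mul_pow (hU.converges_f c hcU) le_rfl d)
  have hFj : F.coeff j ≠ 0 := by
    rw [hFc, Ne, reduce_eq_zero_iff (hF1 j), norm_div, hdj, div_self hd0.ne']
    exact lt_irrefl _
  have hfd : ∀ n : ℕ, ‖evalAt f (c * n) / d‖ ≤ 1 := fun n => by
    rw [norm_div]
    exact div_le_one_of_le₀ (norm_evalAt_le_of_forall hd (hnat n)) hd0.le
  -- `g` converges on the closed disc of radius `‖d‖`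
  have hgd : ∃ y, ‖d‖ ≤ ‖y‖ ∧ ConvergesAt g y := by
    by_contra! hno
    -- If `g` diverged at every point of norm at least `‖d‖`, all values `f(c * n)` would have norm
    -- below `‖d‖`, and `F` would vanish at every natural number.
    have hF0 : F = 0 := polynomial_eq_of_forall_natCast_eval_eq fun n => by
      rw [← reduce_natCast, ← reduce_evalAt_div hF (hnat n), Polynomial.eval_zero,
        reduce_eq_zero_iff (hfd n), norm_div, div_lt_one hd0]
      by_contra! h
      exact hno _ h (hU.converges_g_f _ (hc _ (hnat n)))
    exact hFj (by rw [hF0, Polynomial.coeff_zero])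
  obtain ⟨y, hdy, hgy⟩ := hgd
  -- the normalization of `g`
  have hlim := tendsto_coeff_mul_pow hgy hdy 1
  simp only [div_one] at hlim
  obtain ⟨k, hk⟩ := exists_norm_le_norm hlim
  set e := PowerSeries.coeff k g * d ^ k with he
  clear_value e
  have he0 : 0 < ‖e‖ := by
    refine lt_of_lt_of_le hd0 ?_
    simpa [hg1] using hk 1
  have hk0 : k ≠ 0 := by
    rintro rfl
    simp [he, hg0] at he0
  have hG1 : ∀ l, ‖PowerSeries.coeff l g * d ^ l / e‖ ≤ 1 := fun l => by
    rw [norm_div]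
    exact div_le_one_of_le₀ (hk l) he0.le
  -- Both rescalings of `g` use the same `e`. So `H = G` when `d = c`, while `H` loses all its
  -- coefficients when `‖c‖ < ‖d‖`.
  have hHG : ∀ l, ‖PowerSeries.coeff l g * c ^ l / e‖ =
      ‖PowerSeries.coeff l g * d ^ l / e‖ * (‖c‖ / ‖d‖) ^ l := fun l => by
    rw [norm_div, norm_div, norm_mul, norm_mul, norm_pow, norm_pow, div_pow]
    have := pow_pos hd0 l
    field_simp
  have hcd1 : ‖c‖ / ‖d‖ ≤ 1 := div_le_one_of_le₀ hcd hd0.le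
  have hH1 : ∀ l, ‖PowerSeries.coeff l g * c ^ l / e‖ ≤ 1 := fun l => by
    rw [hHG]
    exact mul_le_one₀ (hG1 l) (by positivity) (pow_le_one₀ (by positivity) hcd1)
  obtain ⟨G, hGc, hG⟩ := exists_reduction hG1 (tendsto_coeff_mul_pow hgy hdy e)
  obtain ⟨H, hHc, hH⟩ := exists_reduction hH1
    (tendsto_coeff_mul_pow (hU.converges_g c hcU) le_rfl e)
  have hGk : G.coeff k ≠ 0 := by
    rw [hGc, Ne, reduce_eq_zero_iff (hG1 k), ← he, norm_div, div_self he0.ne']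
    exact lt_irrefl _
  have hHe : ∀ l, ‖PowerSeries.coeff l g * c ^ l‖ ≤ ‖e‖ := fun l => by
    have := hH1 l
    rwa [norm_div, div_le_one he0] at this
  -- the reduction of the Schröder equation
  have hcomp : G.comp F = Polynomial.C (reduce (PowerSeries.coeff 1 f)) * H :=
    polynomial_eq_of_forall_natCast_eval_eq fun n => by
      rw [Polynomial.eval_comp, Polynomial.eval_C_mul, ← reduce_natCast,
        ← reduce_evalAt_div hF (hnat n), ← reduce_evalAt_div hH (hnat n),
        ← reduce_evalAt_div hG (hfd n), mul_div_cancel₀ _ hd0',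
        hU.schroder _ (hc _ (hnat n)), mul_div_assoc, reduce_mul hf1.le]
      rw [norm_div]
      exact div_le_one_of_le₀ (norm_evalAt_le_of_forall hHe (hnat n)) he0.le
  have hdeg := congrArg Polynomial.natDegree hcomp
  rw [Polynomial.natDegree_comp] at hdeg
  have hGdeg := Polynomial.le_natDegree_of_ne_zero hGk
  have hFdeg := Polynomial.le_natDegree_of_ne_zero hFj
  -- If `d = c`, then `deg G * deg F ≤ deg G` although `deg G ≥ 1` and `deg F ≥ 2`. Otherwise `H =
  -- 0`, so `deg G * deg F = 0` although both factors are positive.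
  rcases hdc with ⟨rfl, hj2⟩ | ⟨hlt', hj1⟩
  · have hle := Polynomial.natDegree_C_mul_le (reduce (PowerSeries.coeff 1 f)) H
    obtain rfl : H = G := Polynomial.ext fun l => by rw [hHc, hGc]
    rw [← hdeg] at hle
    have h1 : 1 ≤ H.natDegree := by omega
    have h2 : 2 ≤ F.natDegree := by omega
    nlinarith
  · have hH0 : H = 0 := Polynomial.ext fun l => by
      rw [hHc, Polynomial.coeff_zero, reduce_eq_zero_iff (hH1 l)]
      rcases Nat.eq_zero_or_pos l with rfl | hl
      · simp [hg0]
      · rw [hHG]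
        exact (mul_le_of_le_one_left (by positivity) (hG1 l)).trans_lt
          (pow_lt_one₀ (by positivity) ((div_lt_one hd0).mpr hlt') hl.ne')
    rw [hH0, mul_zero, Polynomial.natDegree_zero, mul_eq_zero] at hdeg
    omega

end UpperBound

end UltrametricLinearization
namespace UltrametricLinearization

/-! ### Discs and the existence of a greatest one. -/

section Discs

variable {K : Type*} [NontriviallyNormedField K]

theorem mem_eball_zero_iff {x : K} {r : ℝ≥0∞} : x ∈ Metric.eball (0 : K) r ↔ ‖x‖ₑ < r := by
  rw [Metric.mem_eball, edist_zero_right]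

theorem mem_closedEBall_zero_iff {x : K} {r : ℝ≥0∞} :
    x ∈ Metric.closedEBall (0 : K) r ↔ ‖x‖ₑ ≤ r := by
  rw [Metric.mem_closedEBall, edist_zero_right]

/-- A radius-free description, stable under unions. The radius is recovered as the supremum of the
norms; the disc is closed or open according to whether the supremum is attained. -/
theorem isDisc_iff {U : Set K} :
    IsDisc U ↔ (∀ x ∈ U, ∀ y : K, ‖y‖ₑ ≤ ‖x‖ₑ → y ∈ U) ∧ ∃ x ∈ U, x ≠ 0 := by
  constructor
  · rintro ⟨r, hr, hU⟩
    obtain ⟨x, hx0, hx⟩ := (eventually_mem_nhdsWithin.and (nhdsWithin_le_nhds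
      (Metric.eball_mem_nhds (0 : K) hr)) : ∀ᶠ x in nhdsWithin (0 : K) {0}ᶜ,
        x ∈ ({0}ᶜ : Set K) ∧ x ∈ Metric.eball (0 : K) r).exists
    rcases hU with rfl | rfl
    · refine ⟨fun x hx y hy => ?_, x, hx, hx0⟩
      rw [mem_eball_zero_iff] at hx ⊢
      exact hy.trans_lt hx
    · refine ⟨fun x hx y hy => ?_, x, Metric.eball_subset_closedEBall hx, hx0⟩
      rw [mem_closedEBall_zero_iff] at hx ⊢
      exact hy.trans hx
  · rintro ⟨hU, x, hx, hx0⟩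
    refine ⟨⨆ y ∈ U, ‖y‖ₑ, (enorm_pos.mpr hx0).trans_le (le_biSup (fun y : K => ‖y‖ₑ) hx), ?_⟩
    by_cases h : ∃ z ∈ U, ‖z‖ₑ = ⨆ y ∈ U, ‖y‖ₑ
    · obtain ⟨z, hz, hzr⟩ := h
      refine Or.inr (Set.Subset.antisymm (fun y hy => ?_) fun y hy => ?_)
      · exact mem_closedEBall_zero_iff.mpr (le_biSup (fun y : K => ‖y‖ₑ) hy)
      · rw [mem_closedEBall_zero_iff, ← hzr] at hy
        exact hU z hz y hy
    · refine Or.inl (Set.Subset.antisymm (fun y hy => ?_) fun y hy => ?_)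
      · exact mem_eball_zero_iff.mpr ((le_biSup (fun y : K => ‖y‖ₑ) hy).lt_of_ne
          fun he => h ⟨y, hy, he⟩)
      · rw [mem_eball_zero_iff] at hy
        obtain ⟨z, hz, hyz⟩ := lt_biSup_iff.mp hy
        exact hU z hz y hyz.le

theorem IsDisc.subset_or_subset {U V : Set K} (hU : IsDisc U) (hV : IsDisc V) :
    U ⊆ V ∨ V ⊆ U := by
  rw [or_iff_not_imp_left, Set.not_subset]
  rintro ⟨x, hxU, hxV⟩ y hy
  refine (isDisc_iff.mp hU).1 x hxU y (le_of_not_ge fun h => hxV ?_)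
  exact (isDisc_iff.mp hV).1 y hy x h

/-- The union of all admissible discs works: discs about the origin are nested, so any two points
lie in a common one, where `g` is injective. -/
theorem exists_isGreatest_linearizesOn {f g : K⟦X⟧} {U : Set K} (hU : IsDisc U)
    (hfg : LinearizesOn f g U) :
    ∃ Δ, IsGreatest {U : Set K | IsDisc U ∧ LinearizesOn f g U} Δ := by
  refine ⟨⋃₀ {U : Set K | IsDisc U ∧ LinearizesOn f g U}, ⟨?_, ?_⟩,
    fun V hV => Set.subset_sUnion_of_mem hV⟩
  · obtain ⟨-, x, hx, hx0⟩ := isDisc_iff.mp hU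
    refine isDisc_iff.mpr ⟨?_, x, ⟨U, ⟨hU, hfg⟩, hx⟩, hx0⟩
    rintro y ⟨V, hV, hy⟩ z hz
    exact ⟨V, hV, (isDisc_iff.mp hV.1).1 y hy z hz⟩
  · constructor
    · rintro x ⟨V, hV, hx⟩
      exact hV.2.converges_f x hx
    · rintro x ⟨V, hV, hx⟩
      exact hV.2.converges_g x hx
    · rintro x ⟨V, hV, hx⟩
      exact hV.2.converges_g_f x hx
    · rintro x ⟨V, hV, hx⟩
      exact hV.2.schroder x hx
    · rintro x ⟨V, hV, hx⟩ y ⟨W, hW, hy⟩ hxy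
      rcases hV.1.subset_or_subset hW.1 with h | h
      · exact hW.2.injOn (h hx) hy hxy
      · exact hV.2.injOn hx (h hy) hxy

theorem IsLinearizationDisc.unique {f : K⟦X⟧} (hf : ∃! g : K⟦X⟧, IsFormalConjugacy f g)
    {Δ Δ' : Set K} (h : IsLinearizationDisc f Δ) (h' : IsLinearizationDisc f Δ') : Δ' = Δ := by
  obtain ⟨g, hg, hΔ⟩ := h
  obtain ⟨g', hg', hΔ'⟩ := h'
  obtain rfl := hf.unique hg hg'
  exact hΔ'.unique hΔ

end Discs

/-! ### The supremum `a` in terms of coefficient bounds. -/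

section SupCoeff

variable {K : Type*} [NontriviallyNormedField K]

theorem coeffRoot_le_iff (f : K⟦X⟧) (i : ℕ) (A : ℝ≥0∞) :
    coeffRoot f (i + 2) ≤ A ↔ ‖PowerSeries.coeff (i + 2) f‖ₑ ≤ A ^ (i + 1) := by
  have h : ((i + 2 : ℕ) : ℝ) - 1 = ((i + 1 : ℕ) : ℝ) := by
    push_cast
    ring
  rw [coeffRoot, h, one_div, ENNReal.rpow_inv_le_iff (by positivity), ENNReal.rpow_natCast]

theorem le_coeffRoot_iff (f : K⟦X⟧) (i : ℕ) (A : ℝ≥0∞) :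
    A ≤ coeffRoot f (i + 2) ↔ A ^ (i + 1) ≤ ‖PowerSeries.coeff (i + 2) f‖ₑ := by
  have h : ((i + 2 : ℕ) : ℝ) - 1 = ((i + 1 : ℕ) : ℝ) := by
    push_cast
    ring
  rw [coeffRoot, h, one_div, ENNReal.le_rpow_inv_iff (by positivity), ENNReal.rpow_natCast]

theorem supCoeff_le_iff (f : K⟦X⟧) (A : ℝ≥0∞) :
    supCoeff f ≤ A ↔ ∀ i, ‖PowerSeries.coeff (i + 2) f‖ₑ ≤ A ^ (i + 1) := by
  rw [supCoeff, iSup₂_le_iff]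
  refine ⟨fun h i => (coeffRoot_le_iff f i A).mp (h _ (by omega)), fun h i hi => ?_⟩
  obtain ⟨j, rfl⟩ := Nat.exists_eq_add_of_le' hi
  exact (coeffRoot_le_iff f j A).mpr (h j)

theorem coeffRoot_le_supCoeff (f : K⟦X⟧) (i : ℕ) : coeffRoot f (i + 2) ≤ supCoeff f :=
  (coeffRoot_le_iff f i _).mpr ((supCoeff_le_iff f _).mp le_rfl i)

theorem norm_coeff_succ_le {lam : K} (hlam : ‖lam‖ = 1) {f : K⟦X⟧} (hf : IsInFamily lam f)
    (i : ℕ) : ‖PowerSeries.coeff (i + 1) f‖ ≤ (supCoeff f).toReal ^ i := by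
  cases i with
  | zero => simp [hf.coeff_one, hlam]
  | succ i =>
    have h := (supCoeff_le_iff f _).mp le_rfl i
    have h1 := ENNReal.toReal_mono (ENNReal.pow_ne_top hf.supCoeff_ne_top) h
    rwa [ENNReal.toReal_pow, toReal_enorm] at h1

/-- Clearing the denominator treats `A = 0` uniformly: there `E / A` is infinite for `E ≠ 0`, and
the product is 0. -/
theorem toReal_mul_norm_lt {A E : ℝ≥0∞} (hE : E ≠ ∞) {x : K} (h : ‖x‖ₑ < E / A) : A.toReal * ‖x‖ < E.toReal := by
  have h1 := ENNReal.mul_lt_of_lt_div h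
  rw [← toReal_enorm x, ← ENNReal.toReal_mul, mul_comm]
  exact (ENNReal.toReal_lt_toReal (h1.ne_top) hE).mpr h1

end SupCoeff

/-! ### Inner and outer estimates of the linearization disc. -/

section Estimates

variable {K : Type*} [NontriviallyNormedField K] [IsUltrametricDist K] [CompleteSpace K]

/-- Its weak form gives the closed disc of radius `1 / a`. Its strictness excludes the sphere when
the supremum is attained. -/
theorem enorm_coeff_mul_pow_lt_one [CharZero (ResidueField K)] {lam : K} (hlam : ‖lam‖ = 1)
    {f g : K⟦X⟧} (hf : IsInFamily lam f) (hg : IsFormalConjugacy f g) {U : Set K} (hU : IsDisc U)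
    (hfg : LinearizesOn f g U) {c : K} (hc : c ∈ U) (i : ℕ) :
    ‖PowerSeries.coeff (i + 2) f‖ₑ * ‖c‖ₑ ^ (i + 1) < 1 := by
  rcases eq_or_ne c 0 with rfl | hc0
  · simp
  have h := norm_coeff_mul_pow_lt hf.1 (by rw [hf.2, hlam]) hg.1 hg.2 hfg (c := c)
    (fun z hz => (isDisc_iff.mp hU).1 c hc _ (by
      rw [enorm_le_iff_norm_le, norm_mul]
      exact mul_le_of_le_one_right (norm_nonneg c) hz)) (i := i + 2) (by omega) hc0
  rw [pow_succ, ← mul_assoc, norm_mul] at h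
  have h1 : ‖PowerSeries.coeff (i + 2) f * c ^ (i + 1)‖ < 1 :=
    lt_of_mul_lt_mul_right (by rwa [one_mul]) (norm_nonneg c)
  rw [← enorm_pow, ← enorm_mul, ← ofReal_norm]
  exact ENNReal.ofReal_lt_one.mpr h1

theorem linearizesOn_subset_closedEBall [CharZero (ResidueField K)] {lam : K} (hlam : ‖lam‖ = 1)
    {f g : K⟦X⟧} (hf : IsInFamily lam f) (hg : IsFormalConjugacy f g) {U : Set K} (hU : IsDisc U)
    (hfg : LinearizesOn f g U) : U ⊆ Metric.closedEBall 0 (supCoeff f)⁻¹ := by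
  intro c hc
  rw [mem_closedEBall_zero_iff, ENNReal.le_inv_iff_le_inv, supCoeff_le_iff]
  intro i
  rcases eq_or_ne c 0 with rfl | hc0
  · simp
  rw [← ENNReal.inv_pow, ENNReal.le_inv_iff_mul_le]
  exact (enorm_coeff_mul_pow_lt_one hlam hf hg hU hfg hc i).le

theorem linearizesOn_subset_eball [CharZero (ResidueField K)] {lam : K} (hlam : ‖lam‖ = 1)
    {f g : K⟦X⟧} (hf : IsInFamily lam f) (hg : IsFormalConjugacy f g) {U : Set K} (hU : IsDisc U)
    (hfg : LinearizesOn f g U) (h : SupAttained f ∨ DivergesOnSphere f (supCoeff f)⁻¹) :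
    U ⊆ Metric.eball 0 (supCoeff f)⁻¹ := by
  intro c hc
  have hle := mem_closedEBall_zero_iff.mp (linearizesOn_subset_closedEBall hlam hf hg hU hfg hc)
  refine mem_eball_zero_iff.mpr (hle.lt_of_ne fun heq => ?_)
  rcases h with ⟨i, hi, hmax⟩ | h
  · obtain ⟨j, rfl⟩ := Nat.exists_eq_add_of_le' hi
    have h1 := enorm_coeff_mul_pow_lt_one hlam hf hg hU hfg hc j
    have h2 := (le_coeffRoot_iff f j _).mp hmax.ge
    have hA : supCoeff f ≠ 0 := by
      intro h0
      rw [h0, ENNReal.inv_zero] at heq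
      exact enorm_ne_top heq
    rw [heq] at h1
    refine absurd h1 (not_lt.mpr ?_)
    calc (1 : ℝ≥0∞) = supCoeff f ^ (j + 1) * (supCoeff f)⁻¹ ^ (j + 1) := by
          rw [← mul_pow, ENNReal.mul_inv_cancel hA hf.3, one_pow]
      _ ≤ _ := mul_le_mul_left h2 _
  · exact h c heq (hfg.converges_f c hc)

/-- Serves both cases: `m = 1`, `d = 1` without small divisors, and `d = |1 - lam ^ m| ^ (1 / m)`
otherwise. -/
theorem exists_isLinearizationDisc {lam : K} (hlam : ‖lam‖ = 1)
    (hroot : ∀ n : ℕ, 1 ≤ n → lam ^ n ≠ 1) {f : K⟦X⟧} (hf : IsInFamily lam f) {m : ℕ} (hm : m ≠ 0)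
    {d : ℝ} (hd0 : 0 < d) (hd1 : d ≤ 1) (hdvd : ∀ n, n ≠ 0 → m ∣ n → d ^ m ≤ ‖1 - lam ^ n‖)
    (hndvd : ∀ n, ¬ m ∣ n → 1 ≤ ‖1 - lam ^ n‖) :
    ∃ Δ : Set K, IsLinearizationDisc f Δ ∧
      Metric.eball 0 (ENNReal.ofReal d / supCoeff f) ⊆ Δ := by
  have hl0 : lam ≠ 0 := norm_pos_iff.mp (by rw [hlam]; exact one_pos)
  obtain ⟨g, hg, -⟩ := existsUnique_isFormalConjugacy hl0 hroot hf.1 hf.2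
  have hfb := norm_coeff_succ_le hlam hf
  have ha : 0 ≤ (supCoeff f).toReal := ENNReal.toReal_nonneg
  have ht : 1 ≤ d⁻¹ := (one_le_inv₀ hd0).mpr hd1
  have hgb := norm_coeff_conjugacy_le ha ht hm hf.1 (by rw [hf.2, hlam]) hfb hg
    (fun n hn hmn => by
      rw [hf.2, inv_pow, ← div_eq_inv_mul, one_le_div (by positivity)]
      exact hdvd n hn hmn)
    (fun n hmn => by
      rw [hf.2]
      exact hndvd n hmn)
  have hE0 : ENNReal.ofReal d ≠ 0 := (ENNReal.ofReal_pos.mpr hd0).ne'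
  have hlin : LinearizesOn f g (Metric.eball 0 (ENNReal.ofReal d / supCoeff f)) := by
    refine linearizesOn_of_bound hf.1 hg (s := (supCoeff f).toReal * d⁻¹) (by positivity)
      (fun i => (hfb i).trans (pow_le_pow_left₀ ha (le_mul_of_one_le_right ha ht) i)) hgb
      fun x hx => ?_
    have h := toReal_mul_norm_lt ENNReal.ofReal_ne_top (mem_eball_zero_iff.mp hx)
    rw [ENNReal.toReal_ofReal hd0.le] at h
    rw [mul_right_comm, ← div_eq_mul_inv]
    exact (div_lt_one hd0).mpr h
  have hdisc : IsDisc (Metric.eball (0 : K) (ENNReal.ofReal d / supCoeff f)) :=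
    ⟨_, ENNReal.div_pos hE0 hf.3, Or.inl rfl⟩
  obtain ⟨Δ, hΔ⟩ := exists_isGreatest_linearizesOn hdisc hlin
  exact ⟨Δ, ⟨g, hg, hΔ⟩, hΔ.2 ⟨hdisc, hlin⟩⟩

end Estimates

end UltrametricLinearization
namespace UltrametricLinearization

/-! ### Polynomials with a cycle on the critical sphere. -/

section Examples

variable {K : Type*} [NontriviallyNormedField K]

theorem evalAt_coe (P : Polynomial K) (x : K) : evalAt (P : K⟦X⟧) x = P.eval x := by
  rw [evalAt, Polynomial.eval_eq_sum_range]
  simp only [Polynomial.coeff_coe]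
  refine tsum_eq_sum fun i hi => ?_
  rw [Polynomial.coeff_eq_zero_of_natDegree_lt (by simpa using hi), zero_mul]

/-- The polynomial `lam * X + c * X ^ 2 * ∏ j < k, (X - lam ^ j)`. -/
noncomputable def cyclePolynomial (lam c : K) (k : ℕ) : Polynomial K :=
  Polynomial.C lam * Polynomial.X + Polynomial.X ^ 2 *
    (Polynomial.C c * ∏ j ∈ Finset.range k, (Polynomial.X - Polynomial.C (lam ^ j)))

theorem coeff_cyclePolynomial_zero (lam c : K) (k : ℕ) : (cyclePolynomial lam c k).coeff 0 = 0 := by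
  simp [cyclePolynomial]

theorem coeff_cyclePolynomial_one (lam c : K) (k : ℕ) :
    (cyclePolynomial lam c k).coeff 1 = lam := by
  simp [cyclePolynomial, Polynomial.coeff_X_pow_mul']

theorem coeff_cyclePolynomial_add_two (lam c : K) (k i : ℕ) :
    (cyclePolynomial lam c k).coeff (i + 2) =
      c * (∏ j ∈ Finset.range k, (Polynomial.X - Polynomial.C (lam ^ j))).coeff i := by
  rw [cyclePolynomial, Polynomial.coeff_add, Polynomial.coeff_X_pow_mul, Polynomial.coeff_C_mul,
    Polynomial.coeff_C_mul, Polynomial.coeff_X, if_neg (by omega), mul_zero, zero_add]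

theorem eval_cyclePolynomial (lam c : K) (k : ℕ) (x : K) :
    (cyclePolynomial lam c k).eval x =
      lam * x + x ^ 2 * (c * ∏ j ∈ Finset.range k, (x - lam ^ j)) := by
  simp [cyclePolynomial, Polynomial.eval_prod]

theorem eval_cyclePolynomial_pow (lam c : K) {j k : ℕ} (hj : j < k) :
    (cyclePolynomial lam c k).eval (lam ^ j) = lam ^ (j + 1) := by
  rw [eval_cyclePolynomial, Finset.prod_eq_zero (Finset.mem_range.mpr hj) (sub_self _), mul_zero,
    mul_zero, add_zero, pow_succ']

theorem one_mem_periodicPts {lam : K} {P : Polynomial K} {k : ℕ}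
    (h : ∀ j < k, P.eval (lam ^ j) = lam ^ (j + 1)) (hk : P.eval (lam ^ k) = 1) :
    (1 : K) ∈ Function.periodicPts fun y : K => P.eval y := by
  have hit : ∀ j ≤ k, (fun y : K => P.eval y)^[j] 1 = lam ^ j := by
    intro j hj
    induction j with
    | zero => simp
    | succ j ih => rw [Function.iterate_succ_apply', ih (by omega), h j (by omega)]
  refine Function.mk_mem_periodicPts (Nat.succ_pos k) ?_
  rw [Function.IsPeriodicPt, Function.IsFixedPt, Function.iterate_succ_apply', hit k le_rfl, hk]

/-- Along the cycle `g(lam ^ j) = lam ^ j * g(1)`; closing it gives `(1 - lam ^ (k + 1)) * g(1) =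
0`, so `g(1) = g(0)`, against injectivity. -/
theorem subset_eball_of_cycle {lam : K} (hlam : ‖lam‖ = 1)
    (hroot : ∀ n : ℕ, 1 ≤ n → lam ^ n ≠ 1) {P : Polynomial K} {g : K⟦X⟧} {k : ℕ}
    (hP : IsInFamily lam (P : K⟦X⟧)) (hg0 : PowerSeries.coeff 0 g = 0)
    (h : ∀ j < k, P.eval (lam ^ j) = lam ^ (j + 1)) (hk : P.eval (lam ^ k) = 1) {U : Set K}
    (hU : IsDisc U) (hfg : LinearizesOn (P : K⟦X⟧) g U) : U ⊆ Metric.eball 0 1 := by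
  intro y hy
  rw [mem_eball_zero_iff]
  by_contra! hy1
  have hmem : ∀ z : K, ‖z‖ ≤ 1 → z ∈ U := fun z hz => by
    refine (isDisc_iff.mp hU).1 y hy z (le_trans ?_ hy1)
    rw [← ofReal_norm]
    exact ENNReal.ofReal_le_one.mpr hz
  have hs : ∀ j, evalAt g (P.eval (lam ^ j)) = lam * evalAt g (lam ^ j) := fun j => by
    rw [← evalAt_coe, hfg.schroder _ (hmem _ (by simp [hlam])), hP.2]
  have hpow : ∀ j ≤ k, evalAt g (lam ^ j) = lam ^ j * evalAt g 1 := by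
    intro j hj
    induction j with
    | zero => simp
    | succ j ih =>
      have hj' := hs j
      rwa [h j (by omega), ih (by omega), ← mul_assoc, ← pow_succ'] at hj'
  have h1 := hs k
  rw [hk, hpow k le_rfl, ← mul_assoc, ← pow_succ'] at h1
  have h2 : (1 - lam ^ (k + 1)) * evalAt g 1 = 0 := by rw [sub_mul, one_mul, ← h1, sub_self]
  have h3 := (mul_eq_zero.mp h2).resolve_left (sub_ne_zero.mpr (hroot (k + 1) (by omega)).symm)
  have h4 : evalAt g 0 = 0 := by
    rw [evalAt_eq_mul_divX hg0, zero_mul]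
  exact one_ne_zero (hfg.injOn (hmem 1 (by simp)) (hmem 0 (by simp)) (h3.trans h4.symm))

variable [IsUltrametricDist K]

theorem norm_coeff_prod_X_sub_C_le {lam : K} (hlam : ‖lam‖ = 1) (k i : ℕ) :
    ‖(∏ j ∈ Finset.range k, (Polynomial.X - Polynomial.C (lam ^ j))).coeff i‖ ≤ 1 := by
  induction k generalizing i with
  | zero =>
    rw [Finset.prod_range_zero, Polynomial.coeff_one]
    split_ifs <;> simp
  | succ k ih =>
    rw [Finset.prod_range_succ]
    cases i with
    | zero =>
      rw [Polynomial.mul_coeff_zero, norm_mul]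
      exact mul_le_one₀ (ih 0) (norm_nonneg _) (by
        simp [hlam, Polynomial.coeff_zero_eq_eval_zero])
    | succ i =>
      rw [Polynomial.coeff_mul_X_sub_C]
      refine (norm_sub_le_max' _ _).trans (max_le (ih i) ?_)
      rw [norm_mul, norm_pow, hlam, one_pow, mul_one]
      exact ih _

/-- The product is monic with integral coefficients, so `c` is the top coefficient and bounds the
other nonlinear ones. As `‖c‖ ≤ 1`, the root of highest order is the largest. -/
theorem supCoeff_cyclePolynomial {lam : K} (hlam : ‖lam‖ = 1) {c : K} (hc : ‖c‖ ≤ 1) (k : ℕ) :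
    supCoeff (cyclePolynomial lam c k : K⟦X⟧) = ‖c‖ₑ ^ (1 / ((k + 1 : ℕ) : ℝ)) ∧
      coeffRoot (cyclePolynomial lam c k : K⟦X⟧) (k + 2) = ‖c‖ₑ ^ (1 / ((k + 1 : ℕ) : ℝ)) := by
  set E := ‖c‖ₑ ^ (1 / ((k + 1 : ℕ) : ℝ)) with hE
  have hcE : E ^ (k + 1) = ‖c‖ₑ := by
    rw [hE, ← ENNReal.rpow_mul_natCast, one_div_mul_cancel (by positivity), ENNReal.rpow_one]
  have hc1 : ‖c‖ₑ ≤ 1 := by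
    rw [← ofReal_norm]
    exact ENNReal.ofReal_le_one.mpr hc
  have hE1 : E ≤ 1 := ENNReal.rpow_le_one hc1 (by positivity)
  have hdeg : (∏ j ∈ Finset.range k, (Polynomial.X - Polynomial.C (lam ^ j))).natDegree = k := by
    rw [Polynomial.natDegree_finsetProd_X_sub_C_eq_card, Finset.card_range]
  have hle : supCoeff (cyclePolynomial lam c k : K⟦X⟧) ≤ E := by
    refine (supCoeff_le_iff _ _).mpr fun i => ?_
    rw [Polynomial.coeff_coe, coeff_cyclePolynomial_add_two]
    rcases le_or_gt i k with hi | hi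
    · calc _ ≤ ‖c‖ₑ := by
            rw [enorm_le_iff_norm_le, norm_mul]
            exact mul_le_of_le_one_right (norm_nonneg c) (norm_coeff_prod_X_sub_C_le hlam k i)
        _ = E ^ (k + 1) := hcE.symm
        _ ≤ E ^ (i + 1) := pow_le_pow_right_of_le_one' hE1 (by omega)
    · rw [Polynomial.coeff_eq_zero_of_natDegree_lt (by rwa [hdeg]), mul_zero, enorm_zero]
      exact zero_le
  have hge : E ≤ coeffRoot (cyclePolynomial lam c k : K⟦X⟧) (k + 2) := by
    have hmon := Polynomial.monic_prod_X_sub_C (fun j => lam ^ j) (Finset.range k)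
    rw [Polynomial.Monic, Polynomial.leadingCoeff, hdeg] at hmon
    rw [le_coeffRoot_iff, hcE, Polynomial.coeff_coe, coeff_cyclePolynomial_add_two, hmon, mul_one]
  have h := coeffRoot_le_supCoeff (cyclePolynomial lam c k : K⟦X⟧) k
  exact ⟨hle.antisymm (hge.trans h), (h.trans hle).antisymm hge⟩

/-- A polynomial of the family for which `1` is a periodic point, of period `k + 1`. -/
theorem exists_polynomial_cycle {lam : K} (hlam : ‖lam‖ = 1) {k : ℕ}
    (hk : ∀ n, 1 ≤ n → n ≤ k → ‖1 - lam ^ n‖ = 1) :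
    ∃ P : Polynomial K, IsInFamily lam (P : K⟦X⟧) ∧ SupAttained (P : K⟦X⟧) ∧
      supCoeff (P : K⟦X⟧) = ‖1 - lam ^ (k + 1)‖ₑ ^ (1 / ((k + 1 : ℕ) : ℝ)) ∧
      (∀ j < k, P.eval (lam ^ j) = lam ^ (j + 1)) ∧ P.eval (lam ^ k) = 1 := by
  -- The interpolation condition at `lam ^ k` reads `lam ^ (k + 1) + c * D = 1`. Since `D` is a
  -- unit, `c` has the norm of `1 - lam ^ (k + 1)`.
  set D := (lam ^ k) ^ 2 * ∏ j ∈ Finset.range k, (lam ^ k - lam ^ j) with hD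
  have hD1 : ‖D‖ = 1 := by
    rw [hD, norm_mul, norm_pow, norm_pow, hlam, one_pow, one_pow, one_mul, norm_prod]
    refine Finset.prod_eq_one fun j hj => ?_
    have hjk := Finset.mem_range.mp hj
    rw [← hk (k - j) (by omega) (by omega), norm_sub_rev]
    conv_lhs => rw [show k = j + (k - j) by omega, pow_add, ← mul_one_sub, norm_mul, norm_pow, hlam,
      one_pow, one_mul]
  have hD0 : D ≠ 0 := norm_pos_iff.mp (by rw [hD1]; exact one_pos)
  have hc : ‖(1 - lam ^ (k + 1)) / D‖ = ‖1 - lam ^ (k + 1)‖ := by rw [norm_div, hD1, div_one]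
  have hce : ‖(1 - lam ^ (k + 1)) / D‖ₑ = ‖1 - lam ^ (k + 1)‖ₑ := by
    rw [← ofReal_norm, hc, ofReal_norm]
  obtain ⟨h1, h2⟩ := supCoeff_cyclePolynomial hlam
    (hc.le.trans (norm_one_sub_pow_le_one hlam (k + 1))) k
  refine ⟨cyclePolynomial lam ((1 - lam ^ (k + 1)) / D) k, ⟨?_, ?_, ?_⟩,
    ⟨k + 2, by omega, h2.trans h1.symm⟩, by rw [h1, hce], fun j hj => eval_cyclePolynomial_pow _ _ hj,
    ?_⟩
  · rw [Polynomial.coeff_coe, coeff_cyclePolynomial_zero]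
  · rw [Polynomial.coeff_coe, coeff_cyclePolynomial_one]
  · rw [h1]
    exact ENNReal.rpow_ne_top_of_nonneg (by positivity) enorm_ne_top
  · rw [eval_cyclePolynomial, mul_left_comm, ← hD, div_mul_cancel₀ _ hD0]
    ring

end Examples

end UltrametricLinearization
namespace UltrametricLinearization

/-! ### Assembly of the two cases. -/

section Main

variable {K : Type*} [NontriviallyNormedField K]

theorem rho_def (lam : K) (m : ℕ) (f : K⟦X⟧) :
    rho lam m f = ENNReal.ofReal (‖1 - lam ^ m‖ ^ (1 / (m : ℝ))) / supCoeff f := by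
  rw [rho, ← ofReal_norm, ENNReal.ofReal_rpow_of_nonneg (norm_nonneg _) (by positivity)]

variable [IsUltrametricDist K]

theorem IsLinearizationDisc.subset_closedEBall [CompleteSpace K] [CharZero (ResidueField K)]
    {lam : K} (hlam : ‖lam‖ = 1) {f : K⟦X⟧} (hf : IsInFamily lam f) {Δ : Set K}
    (hΔ : IsLinearizationDisc f Δ) : Δ ⊆ Metric.closedEBall 0 (supCoeff f)⁻¹ := by
  obtain ⟨g, hg, h⟩ := hΔ
  exact linearizesOn_subset_closedEBall hlam hf hg h.1.1 h.1.2

theorem IsLinearizationDisc.subset_eball [CompleteSpace K] [CharZero (ResidueField K)]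
    {lam : K} (hlam : ‖lam‖ = 1) {f : K⟦X⟧} (hf : IsInFamily lam f) {Δ : Set K}
    (hΔ : IsLinearizationDisc f Δ) (h : SupAttained f ∨ DivergesOnSphere f (supCoeff f)⁻¹) :
    Δ ⊆ Metric.eball 0 (supCoeff f)⁻¹ := by
  obtain ⟨g, hg, h'⟩ := hΔ
  exact linearizesOn_subset_eball hlam hf hg h'.1.1 h'.1.2 h

theorem norm_one_sub_pow_of_not_isOfFinOrder {lam : K} (hlam : ‖lam‖ = 1)
    (h : ¬ IsOfFinOrder (residue lam hlam.le)) {n : ℕ} (hn : 1 ≤ n) : ‖1 - lam ^ n‖ = 1 :=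
  (norm_one_sub_pow_le_one hlam n).antisymm (not_lt.mp fun h1 =>
    h ((isOfFinOrder_residue_iff hlam).mpr ⟨n, hn, h1⟩))

/-- If the residue class of `lam` is not a root of unity, then the linearization disc contains the
open disc of radius `1 / a`. -/
theorem exists_isLinearizationDisc_of_not_isOfFinOrder [CompleteSpace K] {lam : K}
    (hlam : ‖lam‖ = 1) (hroot : ∀ n : ℕ, 1 ≤ n → lam ^ n ≠ 1)
    (h : ¬ IsOfFinOrder (residue lam hlam.le)) {f : K⟦X⟧} (hf : IsInFamily lam f) :
    ∃ Δ : Set K, IsLinearizationDisc f Δ ∧ Metric.eball 0 (supCoeff f)⁻¹ ⊆ Δ := by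
  obtain ⟨Δ, hΔ, hsub⟩ := exists_isLinearizationDisc hlam hroot hf one_ne_zero one_pos le_rfl
    (fun n hn _ => by
      rw [norm_one_sub_pow_of_not_isOfFinOrder hlam h (Nat.one_le_iff_ne_zero.mpr hn), one_pow])
    (fun n hn => absurd (one_dvd n) hn)
  rw [ENNReal.ofReal_one, one_div] at hsub
  exact ⟨Δ, hΔ, hsub⟩

/-- If `m` is the order of the residue class of `lam`, then the linearization disc contains the
open disc of radius `ρ`. -/
theorem exists_isLinearizationDisc_of_isLeast [CompleteSpace K] [CharZero (ResidueField K)]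
    {lam : K} (hlam : ‖lam‖ = 1) (hroot : ∀ n : ℕ, 1 ≤ n → lam ^ n ≠ 1) {m : ℕ}
    (hm : IsLeast {n : ℕ | 1 ≤ n ∧ ‖1 - lam ^ n‖ < 1} m) {f : K⟦X⟧} (hf : IsInFamily lam f) :
    ∃ Δ : Set K, IsLinearizationDisc f Δ ∧ Metric.eball 0 (rho lam m f) ⊆ Δ := by
  have hm0 : m ≠ 0 := Nat.one_le_iff_ne_zero.mp hm.1.1
  have hpos : 0 < ‖1 - lam ^ m‖ := norm_pos_iff.mpr (sub_ne_zero.mpr (hroot m hm.1.1).symm)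
  rw [rho_def]
  refine exists_isLinearizationDisc hlam hroot hf hm0 (Real.rpow_pos_of_pos hpos _)
    (Real.rpow_le_one hpos.le hm.1.2.le (by positivity)) (fun n hn hmn => ?_)
    (fun n hn => (norm_one_sub_pow_of_not_dvd hlam hm hn).ge)
  rw [norm_one_sub_pow_of_dvd hlam hm.1.2 hn hmn, one_div, Real.rpow_inv_natCast_pow hpos.le hm0]

end Main

end UltrametricLinearization

open UltrametricLinearization in
theorem mainTheorem1 {K : Type*} [NontriviallyNormedField K] [CompleteSpace K]
    [IsUltrametricDist K] [CharZero K] [CharZero (ResidueField K)]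
    (lam : K) (hlam : ‖lam‖ = 1) (hroot : ∀ n : ℕ, 1 ≤ n → lam ^ n ≠ 1) :
    -- the linearization disc exists, and its size is estimated
    (∀ f : K⟦X⟧, IsInFamily lam f →
      (∃! g : K⟦X⟧, IsFormalConjugacy f g) ∧
      ∃ Δ : Set K, IsLinearizationDisc f Δ ∧ (∀ Δ' : Set K, IsLinearizationDisc f Δ' → Δ' = Δ) ∧
        (¬ IsOfFinOrder (residue lam hlam.le) →
          Metric.eball 0 (supCoeff f)⁻¹ ⊆ Δ ∧ Δ ⊆ Metric.closedEBall 0 (supCoeff f)⁻¹ ∧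
          (SupAttained f ∨ DivergesOnSphere f (supCoeff f)⁻¹ →
            Δ = Metric.eball 0 (supCoeff f)⁻¹)) ∧
        (IsOfFinOrder (residue lam hlam.le) →
          ∃ m : ℕ, IsLeast {n : ℕ | 1 ≤ n ∧ ‖1 - lam ^ n‖ < 1} m ∧
            Metric.eball 0 (rho lam m f) ⊆ Δ ∧ Δ ⊆ Metric.closedEBall 0 (supCoeff f)⁻¹ ∧
            (SupAttained f ∨ DivergesOnSphere f (supCoeff f)⁻¹ →
              Metric.eball 0 (rho lam m f) ⊆ Δ ∧ Δ ⊆ Metric.eball 0 (supCoeff f)⁻¹))) ∧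
    -- the estimates are maximal: first case
    (¬ IsOfFinOrder (residue lam hlam.le) →
      ∃ P : Polynomial K, IsInFamily lam (P : K⟦X⟧) ∧
        (∃ x : K, ‖x‖ₑ = (supCoeff (P : K⟦X⟧))⁻¹ ∧
          x ∈ Function.periodicPts (fun y : K => P.eval y)) ∧
        IsLinearizationDisc (P : K⟦X⟧) (Metric.eball 0 (supCoeff (P : K⟦X⟧))⁻¹)) ∧
    -- the estimates are maximal: second case
    (∀ m : ℕ, IsOfFinOrder (residue lam hlam.le) →
      IsLeast {n : ℕ | 1 ≤ n ∧ ‖1 - lam ^ n‖ < 1} m →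
      ∃ P : Polynomial K, IsInFamily lam (P : K⟦X⟧) ∧
        (∃ x : K, ‖x‖ₑ = rho lam m (P : K⟦X⟧) ∧
          x ∈ Function.periodicPts (fun y : K => P.eval y)) ∧
        IsLinearizationDisc (P : K⟦X⟧) (Metric.eball 0 (rho lam m (P : K⟦X⟧)))) := by
  refine ⟨fun f hf => ?_, fun h => ?_, fun m _ hm => ?_⟩
  · have hl0 : lam ≠ 0 := norm_pos_iff.mp (by rw [hlam]; exact one_pos)
    have huniq := existsUnique_isFormalConjugacy hl0 hroot hf.1 hf.2
    refine ⟨huniq, ?_⟩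
    by_cases h : IsOfFinOrder (residue lam hlam.le)
    · have hex := (isOfFinOrder_residue_iff hlam).mp h
      obtain ⟨m, hm⟩ : ∃ m, IsLeast {n : ℕ | 1 ≤ n ∧ ‖1 - lam ^ n‖ < 1} m :=
        ⟨_, isLeast_csInf hex⟩
      obtain ⟨Δ, hΔ, hsub⟩ := exists_isLinearizationDisc_of_isLeast hlam hroot hm hf
      exact ⟨Δ, hΔ, fun Δ' hΔ' => hΔ.unique huniq hΔ', fun h' => absurd h h', fun _ =>
        ⟨m, hm, hsub, hΔ.subset_closedEBall hlam hf, fun h' => ⟨hsub, hΔ.subset_eball hlam hf h'⟩⟩⟩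
    · obtain ⟨Δ, hΔ, hsub⟩ := exists_isLinearizationDisc_of_not_isOfFinOrder hlam hroot h hf
      exact ⟨Δ, hΔ, fun Δ' hΔ' => hΔ.unique huniq hΔ', fun _ =>
        ⟨hsub, hΔ.subset_closedEBall hlam hf, fun h' => (hΔ.subset_eball hlam hf h').antisymm hsub⟩,
        fun h' => absurd h' h⟩
  -- The polynomial is `lam * x + (1 - lam) * x ^ 2`, with fixed point 1 and `a = 1`.
  · obtain ⟨P, hP, hatt, hsup, hcyc, hcyc'⟩ := exists_polynomial_cycle hlam (k := 0)
      (fun n h1 h2 => by omega)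
    have hsup1 : supCoeff (P : K⟦X⟧) = 1 := by
      rw [hsup, ← ofReal_norm, norm_one_sub_pow_of_not_isOfFinOrder hlam h le_rfl,
        ENNReal.ofReal_one, ENNReal.one_rpow]
    obtain ⟨Δ, hΔ, hsub⟩ := exists_isLinearizationDisc_of_not_isOfFinOrder hlam hroot h hP
    refine ⟨P, hP, ⟨1, by rw [hsup1, inv_one, enorm_one], one_mem_periodicPts hcyc hcyc'⟩, ?_⟩
    rwa [hsub.antisymm (hΔ.subset_eball hlam hP (Or.inl hatt))]
  · obtain ⟨k, rfl⟩ := Nat.exists_eq_add_of_le' hm.1.1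
    obtain ⟨P, hP, -, hsup, hcyc, hcyc'⟩ := exists_polynomial_cycle hlam (k := k)
      (fun n h1 h2 => norm_one_sub_pow_of_not_dvd hlam hm fun hdvd =>
        absurd (Nat.le_of_dvd h1 hdvd) (by omega))
    -- With period `m = k + 1` the supremum `a` equals the numerator of `ρ`, so the cycle through 1
    -- lies on the sphere of radius `ρ`.
    have hrho : rho lam (k + 1) (P : K⟦X⟧) = 1 := by
      have h0 : supCoeff (P : K⟦X⟧) ≠ 0 := by
        rw [hsup, Ne, ENNReal.rpow_eq_zero_iff_of_pos (by positivity), enorm_eq_zero, sub_eq_zero]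
        exact (hroot (k + 1) hm.1.1).symm
      rw [rho, ← hsup]
      exact ENNReal.div_self h0 hP.3
    obtain ⟨Δ, hΔ, hsub⟩ := exists_isLinearizationDisc_of_isLeast hlam hroot hm hP
    refine ⟨P, hP, ⟨1, by rw [hrho, enorm_one], one_mem_periodicPts hcyc hcyc'⟩, ?_⟩
    obtain ⟨g, hg, hgr⟩ := id hΔ
    have hsub' := subset_eball_of_cycle hlam hroot hP hg.1 hcyc hcyc' hgr.1.1 hgr.1.2
    rw [← hrho] at hsub'
    rwa [hsub.antisymm hsub']
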